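/- Let $\lambda,\mu,U>0$ and $\rho=\lambda/\mu$. Let $p=(p_k)_{k\ge0}$ be a probability distribution on $\mathbb N$ with mean $\sum_{k\ge0}k\,p_k=U$, and put $N(z,0)=\sum_{k\ge0}p_kz^k$ for $|z|\le1$. For a continuous function $\delta:[0,\infty)\to\mathbb R$, $z\ne0$ and $0\le s\le t$, put $$\varphi_\delta(z,t)=\exp\Bigl\{\Bigl(1-\frac1z\Bigr)\int_0^t\bigl(\lambda-z\,\delta(u)\bigr)\,du\Bigr\},$$ $$\psi_\delta(t)=\frac1{2i\pi}\int_{\mathcal L}\frac{N(z,0)}{z\,\varphi_\delta(z,t)}\,dz,\qquad D_\delta(s,t)=\frac1{2i\pi}\int_{\mathcal L}\frac{\varphi_\delta(z,s)}{\varphi_\delta(z,t)}\,\frac{1-1/z}{z}\,dz,$$ where $\mathcal L$ is a circle $|z|=r$ with $0<r\le1$, positively oriented. Consider the integro-differential system, for $t\ge0$, $$\frac{d\delta(t)}{dt}+\mu\,\delta(t)=\lambda\mu\,(1-H(t)),\quad \delta(0)=0,\qquad H(t)=\psi_\delta(t)+\lambda\int_0^tD_\delta(s,t)\,H(s)\,ds,$$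 in which $\delta$ is differentiable and $H$ is continuous on $[0,\infty)$, both real-valued. Then: 1. The system has a unique solution $(\delta,H)$ on $[0,\infty)$. 2. For this solution $\delta\ge0$, and $H(t)$ is the probability that the $M(t)/M/1$ queue with arrival rate $\delta(t)$, service rate $\lambda$ and initial law $p$ is empty at time $t$. That is, the forward Kolmogorov equations $$q_0'=-\delta q_0+\lambda q_1,\qquad q_n'=\delta q_{n-1}-(\delta+\lambda)q_n+\lambda q_{n+1}\quad(n\ge1),\qquad q_n(0)=p_n,$$ have a solution $(q_n(t))_{n\ge0}$ that is a probability distribution for every $t\ge0$, and every such solution satisfies $H(t)=q_0(t)$ for all $t\ge0$. 3. The limit $\lim_{t\to\infty}\delta(t)$ exists, is finite and positive, and equals $$\frac{\mu\Bigl(U+\rho+1-\sqrt{(U+\rho+1)^2-4\rho U}\Bigr)}2 .$$ -/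

import Mathlib

namespace TandemQueue

/-- Generating function `N(z,0) = ∑ₖ pₖ zᵏ` of the initial law `p` of the second queue. -/
noncomputable def initialGen (p : ℕ → ℝ) (z : ℂ) : ℂ :=
  ∑' k : ℕ, (p k : ℂ) * z ^ k

/-- `φ(z,t) = exp ((1 - 1/z) ∫₀ᵗ (lam - z δ(s)) ds)`. -/
noncomputable def phi (lam : ℝ) (δ : ℝ → ℝ) (z : ℂ) (t : ℝ) : ℂ :=
  Complex.exp ((1 - 1 / z) * ∫ s in (0 : ℝ)..t, ((lam : ℂ) - z * (δ s : ℂ)))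

/-- `ψ(t) = (1/2πi) ∮ N(z,0) / (z φ(z,t)) dz`, the contour being the circle `|z| = r`. -/
noncomputable def psi (lam : ℝ) (p : ℕ → ℝ) (r : ℝ) (δ : ℝ → ℝ) (t : ℝ) : ℂ :=
  (2 * (Real.pi : ℂ) * Complex.I)⁻¹ *
    ∮ z in C((0 : ℂ), r), initialGen p z / (z * phi lam δ z t)

/-- `D(s,t) = (1/2πi) ∮ (φ(z,s)/φ(z,t)) ((1 - 1/z)/z) dz`, the contour being `|z| = r`. -/
noncomputable def kernelD (lam r : ℝ) (δ : ℝ → ℝ) (s t : ℝ) : ℂ :=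
  (2 * (Real.pi : ℂ) * Complex.I)⁻¹ *
    ∮ z in C((0 : ℂ), r), phi lam δ z s / phi lam δ z t * ((1 - 1 / z) / z)

/-- `(δ, H)` solves on `[0,∞)` the integro-differential system
`δ' + mu δ = lam mu (1 - H)`, `δ(0) = 0`, `H(t) = ψ(t) + lam ∫₀ᵗ D(s,t) H(s) ds`,
with `H` continuous (the derivative at `0` is one-sided; values at negative times are
irrelevant). -/
structure IsSolution (lam mu : ℝ) (p : ℕ → ℝ) (r : ℝ) (δ H : ℝ → ℝ) : Prop where
  continuousOn : ContinuousOn H (Set.Ici 0)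
  initial : δ 0 = 0
  deriv : ∀ t : ℝ, 0 ≤ t →
    HasDerivWithinAt δ (lam * mu * (1 - H t) - mu * δ t) (Set.Ici 0) t
  volterra : ∀ t : ℝ, 0 ≤ t →
    (H t : ℂ) = psi lam p r δ t +
      (lam : ℂ) * ∫ s in (0 : ℝ)..t, kernelD lam r δ s t * (H s : ℂ)

/-- `q n t` is the probability that the `M(t)/M/1` queue with arrival rate `δ(t)`, service rate
`lam` and initial law `p` holds `n` customers at time `t`: a family of probability laws solving
the forward Kolmogorov equations. -/
structure IsQueueLaw (lam : ℝ) (p : ℕ → ℝ) (δ : ℝ → ℝ) (q : ℕ → ℝ → ℝ) : Prop where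
  initial : ∀ n : ℕ, q n 0 = p n
  nonneg : ∀ (n : ℕ) (t : ℝ), 0 ≤ t → 0 ≤ q n t
  hasSum_one : ∀ t : ℝ, 0 ≤ t → HasSum (fun n : ℕ => q n t) 1
  deriv_zero : ∀ t : ℝ, 0 ≤ t →
    HasDerivWithinAt (q 0) (-(δ t * q 0 t) + lam * q 1 t) (Set.Ici 0) t
  deriv_succ : ∀ (n : ℕ) (t : ℝ), 0 ≤ t →
    HasDerivWithinAt (q (n + 1))
      (δ t * q n t - (δ t + lam) * q (n + 1) t + lam * q (n + 2) t) (Set.Ici 0) t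

end TandemQueue

namespace TandemQueue

open Set Filter Topology MeasureTheory
open scoped NNReal BoundedContinuousFunction lp

/-! The integral equation is the generating-function form of the Kolmogorov equations closed by the
feedback `δ' = lam mu (1 - q 0) - mu δ`. With `G(z,t) = ∑ q n t zⁿ` those equations read `∂G/∂t = (1
- 1/z)((z δ - lam) G + lam q 0)`, and `φ` is the integrating factor. Dividing the integrated
identity by `z φ(z,t)` and integrating over the circle isolates `q 0` by Cauchy's formula and
produces `ψ` and `D` (`phi_mul_initialGen`, `volterra_of_isQueueLaw`).

Existence is therefore sought in the nonlinear Kolmogorov system on `ℝ × ℓ¹`. The states with `0 ≤ δ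
≤ lam` and `q` a probability law form a bounded closed convex set, which a short Euler step
preserves; the flow, Lipschitz there, is then global (`exists_global_solution`). Uniqueness of the
pair, and of `H` once `δ` is given, is a Grönwall argument, because `ψ` and `D` are Lipschitz in the
primitive of `δ` on bounded time intervals (`eq_of_volterra`).

For the limit, pass to the tails `s n`. The mass `δ/mu + ∑ s (n+1)` is constantly `U`, and the
equilibria are `δ = lam x`, `s n = xⁿ`. The deviation from any equilibrium solves a linear system
with nonnegative off-diagonal coefficients and conserved total, so the sum of its positive parts is
nonincreasing (`totalEnergy_le`). Taking `x` near `1` makes the tails summable uniformly in time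
(`exists_tsum_tail_le`). Taking the `x` whose equilibrium has mass `U`, the deviations sum to zero:
if `δ` is away from `lam x`, some tail of bounded index deviates with the opposite sign
(`exists_opposite_sign`), and the energy then falls at a definite rate. A nonnegative energy cannot
do this for ever and `δ` is Lipschitz, so `δ` tends to `lam x`; a quadratic equation gives `x`. -/

/-! ### Long-time behaviour: conserved mass and decreasing energies -/

/-- At a zero of `f` the right slope of the positive part is the positive part of `f'`, so a factor
`χ` exists even at sign changes. This lets the energies, sums of positive parts, be differentiated
to the right at every time. -/
theorem exists_hasDerivWithinAt_max_zero {f : ℝ → ℝ} {f' t : ℝ}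
    (h : HasDerivWithinAt f f' (Ici t) t) :
    ∃ χ : ℝ, 0 ≤ χ ∧ χ ≤ 1 ∧ (0 < f t → χ = 1) ∧ (f t < 0 → χ = 0) ∧
      HasDerivWithinAt (fun s => max (f s) 0) (χ * f') (Ici t) t := by
  rcases lt_trichotomy (f t) 0 with hneg | hzero | hpos
  · refine ⟨0, le_rfl, zero_le_one, fun h' => absurd h' hneg.not_gt, fun _ => rfl, ?_⟩
    have hev : (fun s => max (f s) 0) =ᶠ[𝓝[Ici t] t] fun _ => (0 : ℝ) := by
      filter_upwards [h.continuousWithinAt.eventually (gt_mem_nhds hneg)] with s hs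
      exact max_eq_right hs.le
    simpa using (hasDerivWithinAt_const t (Ici t) (0 : ℝ)).congr_of_eventuallyEq hev
      (max_eq_right hneg.le)
  · have key : HasDerivWithinAt (fun s => max (f s) 0) (max f' 0) (Ici t) t := by
      rw [hasDerivWithinAt_iff_tendsto_slope, Ici_sdiff_left] at h ⊢
      refine (h.max tendsto_const_nhds).congr' ?_
      filter_upwards [self_mem_nhdsWithin] with s hs
      have hs' : 0 < s - t := sub_pos.2 hs
      simp only [slope_def_field, hzero, max_self, sub_zero]
      rw [max_div_div_right hs'.le (f s) 0 |>.symm]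
      simp
    by_cases hf' : 0 < f'
    · refine ⟨1, zero_le_one, le_rfl, fun _ => rfl, fun h' => absurd h' hzero.not_lt, ?_⟩
      simpa [max_eq_left hf'.le] using key
    · refine ⟨0, le_rfl, zero_le_one, fun h' => absurd h' hzero.not_gt, fun _ => rfl, ?_⟩
      simpa [max_eq_right (not_lt.1 hf')] using key
  · refine ⟨1, zero_le_one, le_rfl, fun _ => rfl, fun h' => absurd h' hpos.not_gt, ?_⟩
    have hev : (fun s => max (f s) 0) =ᶠ[𝓝[Ici t] t] f := by
      filter_upwards [h.continuousWithinAt.eventually (lt_mem_nhds hpos)] with s hs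
      exact max_eq_left hs.le
    simpa using h.congr_of_eventuallyEq hev (max_eq_left hpos.le)

theorem hasDerivWithinAt_linear (a b t : ℝ) (S : Set ℝ) :
    HasDerivWithinAt (fun t => a + b * t) b S t := by
  simpa using ((hasDerivWithinAt_id t S).const_mul b).const_add a

/-- The tails `s n = ∑_{k ≥ n} q k` of the law of the second queue, coupled with the rate `δ`. -/
structure IsTailFlow (lam mu U : ℝ) (δ : ℝ → ℝ) (s : ℕ → ℝ → ℝ) : Prop where
  zero : ∀ t, 0 ≤ t → s 0 t = 1
  succ_le : ∀ n t, 0 ≤ t → s (n + 1) t ≤ s n t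
  nonneg : ∀ n t, 0 ≤ t → 0 ≤ s n t
  rate_zero : δ 0 = 0
  rate_nonneg : ∀ t, 0 ≤ t → 0 ≤ δ t
  deriv_rate : ∀ t, 0 ≤ t → HasDerivWithinAt δ (lam * mu * s 1 t - mu * δ t) (Ici 0) t
  deriv : ∀ n t, 0 ≤ t → HasDerivWithinAt (s (n + 1))
    (δ t * (s n t - s (n + 1) t) - lam * (s (n + 1) t - s (n + 2) t)) (Ici 0) t
  hasSum : HasSum (fun n => s (n + 1) 0) U

/-- The positive part of the distance between the flow and the equilibrium of parameter `x`,
truncated to the first `K` tails. -/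
noncomputable def energy (lam mu : ℝ) (δ : ℝ → ℝ) (s : ℕ → ℝ → ℝ) (x : ℝ) (K : ℕ) (t : ℝ) : ℝ :=
  max ((δ t - lam * x) / mu) 0 + ∑ n ∈ Finset.range K, max (s (n + 1) t - x ^ (n + 1)) 0

namespace IsTailFlow

variable {lam mu U : ℝ} {δ : ℝ → ℝ} {s : ℕ → ℝ → ℝ}

theorem antitone (h : IsTailFlow lam mu U δ s) {t : ℝ} (ht : 0 ≤ t) :
    Antitone fun n => s n t :=
  antitone_nat_of_succ_le fun n => h.succ_le n t ht

theorem le_one (h : IsTailFlow lam mu U δ s) (n : ℕ) {t : ℝ} (ht : 0 ≤ t) : s n t ≤ 1 :=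
  (h.antitone ht (Nat.zero_le n)).trans (h.zero t ht).le

/-- Everything telescopes except the flux across the truncation level; `δ / mu` absorbs the
departures `lam * s 1 t`. -/
theorem hasDerivWithinAt_mass (h : IsTailFlow lam mu U δ s) (hmu : mu ≠ 0) (K : ℕ) {t : ℝ}
    (ht : 0 ≤ t) :
    HasDerivWithinAt (fun t => δ t / mu + ∑ n ∈ Finset.range K, s (n + 1) t)
      (lam * s (K + 1) t - δ t * s K t) (Ici 0) t := by
  have h1 := ((h.deriv_rate t ht).div_const mu).add
    (HasDerivWithinAt.fun_sum (u := Finset.range K) fun n _ => h.deriv n t ht)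
  refine h1.congr_deriv ?_
  rw [Finset.sum_sub_distrib, ← Finset.mul_sum, ← Finset.mul_sum,
    Finset.sum_range_sub' (fun n => s n t), Finset.sum_range_sub' (fun n => s (n + 1) t),
    h.zero t ht]
  field_simp
  ring

theorem sum_range_le_initial (h : IsTailFlow lam mu U δ s) (K : ℕ) :
    ∑ n ∈ Finset.range K, s (n + 1) 0 ≤ U :=
  sum_le_hasSum _ (fun _ _ => h.nonneg _ 0 le_rfl) h.hasSum

/-- A crude bound growing with time, available before conservation is known. It controls the
boundary flux on compact intervals, which is what the proof of conservation needs. -/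
theorem mass_le (h : IsTailFlow lam mu U δ s) (hlam : 0 ≤ lam) (hmu : mu ≠ 0) (K : ℕ) {t : ℝ}
    (ht : 0 ≤ t) :
    δ t / mu + ∑ n ∈ Finset.range K, s (n + 1) t ≤ U + lam * t := by
  refine image_le_of_deriv_right_le_deriv_boundary (a := 0) (b := t)
    (f := fun t => δ t / mu + ∑ n ∈ Finset.range K, s (n + 1) t)
    (B := fun t => U + lam * t) (B' := fun _ => lam)
    (fun x hx => (h.hasDerivWithinAt_mass hmu K hx.1).continuousWithinAt.mono fun y hy => hy.1)
    (fun x hx => (h.hasDerivWithinAt_mass hmu K hx.1).mono (Ici_subset_Ici.2 hx.1))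
    ?_ (by fun_prop) (fun x _ => hasDerivWithinAt_linear _ _ _ _) ?_ ⟨ht, le_rfl⟩
  · simpa [h.rate_zero] using h.sum_range_le_initial K
  · intro x hx
    have h1 := mul_nonneg (h.rate_nonneg x hx.1) (h.nonneg K x hx.1)
    have h2 := mul_le_mul_of_nonneg_left (h.le_one (K + 1) hx.1) hlam
    linarith

theorem mul_tail_le_sum (h : IsTailFlow lam mu U δ s) (K : ℕ) {t : ℝ} (ht : 0 ≤ t) :
    K * s K t ≤ ∑ n ∈ Finset.range K, s (n + 1) t := by
  have := Finset.card_nsmul_le_sum (Finset.range K) (fun n => s (n + 1) t) (s K t)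
    fun n hn => h.antitone ht (Nat.succ_le_of_lt (Finset.mem_range.1 hn))
  simpa using this

theorem tail_le_of_mem_Icc (h : IsTailFlow lam mu U δ s) (hlam : 0 ≤ lam) (hmu : 0 < mu) (K : ℕ)
    {t T : ℝ} (ht : 0 ≤ t) (htT : t ≤ T) : s (K + 1) t ≤ (U + lam * T) / (K + 1) := by
  rw [le_div_iff₀ (by positivity)]
  have h1 := h.mass_le hlam hmu.ne' (K + 1) ht
  have h2 := h.mul_tail_le_sum (K + 1) ht
  have h3 := div_nonneg (h.rate_nonneg t ht) hmu.le
  have h4 := mul_le_mul_of_nonneg_left htT hlam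
  push_cast at h2
  nlinarith

/-- The total number of customers is conserved. -/
theorem hasSum_tail (h : IsTailFlow lam mu U δ s) (hlam : 0 ≤ lam) (hmu : 0 < mu)
    {t : ℝ} (ht : 0 ≤ t) : HasSum (fun n => s (n + 1) t) (U - δ t / mu) := by
  rw [hasSum_iff_tendsto_nat_of_nonneg fun n => h.nonneg _ t ht]
  have hδ : ContinuousOn δ (Ici 0) := fun x hx => (h.deriv_rate x hx).continuousWithinAt
  obtain ⟨B, hB⟩ := (isCompact_Icc (a := (0 : ℝ)) (b := t)).exists_bound_of_continuousOn
    (hδ.mono fun y hy => hy.1)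
  have hB0 : 0 ≤ B := (norm_nonneg _).trans (hB 0 ⟨le_rfl, ht⟩)
  set C := U + lam * t
  have hC : 0 ≤ C := by
    have := h.mass_le hlam hmu.ne' 0 ht
    have h3 := div_nonneg (h.rate_nonneg t ht) hmu.le
    simp at this
    linarith
  -- By `mul_tail_le_sum` the flux across level `K + 1` is `O(1 / K)` uniformly on `[0, t]`, so the
  -- truncated mass changes by a vanishing amount.
  have key : ∀ K : ℕ, ‖(δ t / mu + ∑ n ∈ Finset.range (K + 1), s (n + 1) t) -
      (δ 0 / mu + ∑ n ∈ Finset.range (K + 1), s (n + 1) 0)‖ ≤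
      ((lam + B) * (C / (K + 1))) * (t - 0) := by
    intro K
    refine norm_image_sub_le_of_norm_deriv_le_segment'
      (f := fun t => δ t / mu + ∑ n ∈ Finset.range (K + 1), s (n + 1) t)
      (fun x hx => (h.hasDerivWithinAt_mass hmu.ne' (K + 1) hx.1).mono fun y hy => hy.1)
      (fun x hx => ?_) t ⟨ht, le_rfl⟩
    have h1 := h.tail_le_of_mem_Icc hlam hmu K hx.1 hx.2.le
    have h2 := h.nonneg (K + 1) x hx.1
    have h3 := h.nonneg (K + 2) x hx.1
    have h4 := h.succ_le (K + 1) x hx.1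
    have h5 := h.rate_nonneg x hx.1
    have h6 : δ x ≤ B := (le_abs_self _).trans (hB x ⟨hx.1, hx.2.le⟩)
    have h7 := mul_le_mul h6 h1 h2 hB0
    have h8 := mul_le_mul_of_nonneg_left (h4.trans h1) hlam
    have h9 := mul_nonneg hlam h3
    have h10 := mul_nonneg h5 h2
    have h11 : 0 ≤ B * (C / (K + 1)) := by positivity
    have h12 : 0 ≤ lam * (C / (K + 1)) := by positivity
    rw [Real.norm_eq_abs, abs_le, add_mul]
    constructor <;> linarith
  have hlim : Tendsto (fun K : ℕ => ((lam + B) * (C / ((K : ℝ) + 1))) * (t - 0)) atTop (𝓝 0) := by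
    have := ((tendsto_const_div_atTop_nhds_zero_nat C).comp (tendsto_add_atTop_nat 1))
    have h2 := (this.const_mul (lam + B)).mul_const (t - 0)
    simpa [Function.comp_def] using h2
  have h1 := squeeze_zero_norm key hlim
  have h2 := (tendsto_add_atTop_iff_nat 1).2 h.hasSum.tendsto_sum_nat
  rw [← tendsto_add_atTop_iff_nat 1]
  have h3 := (h1.add h2).sub_const (δ t / mu)
  simp only [h.rate_zero, zero_div, zero_add] at h3
  exact h3.congr fun K => by ring

theorem tail_le (h : IsTailFlow lam mu U δ s) (hlam : 0 ≤ lam) (hmu : 0 < mu) (K : ℕ)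
    {t : ℝ} (ht : 0 ≤ t) : s (K + 1) t ≤ U / (K + 1) := by
  rw [le_div_iff₀ (by positivity)]
  have h1 := sum_le_hasSum (Finset.range (K + 1)) (fun n _ => h.nonneg _ t ht)
    (h.hasSum_tail hlam hmu ht)
  have h2 := h.mul_tail_le_sum (K + 1) ht
  have h3 := div_nonneg (h.rate_nonneg t ht) hmu.le
  push_cast at h2
  nlinarith

theorem rate_le (h : IsTailFlow lam mu U δ s) (hlam : 0 ≤ lam) (hmu : 0 < mu)
    {t : ℝ} (ht : 0 ≤ t) : δ t ≤ mu * U := by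
  have h1 := (h.hasSum_tail hlam hmu ht).nonneg fun n => h.nonneg _ t ht
  rw [sub_nonneg, div_le_iff₀ hmu] at h1
  linarith

/-- Subtracting the equilibrium leaves a linear system for the deviations whose couplings have
nonnegative coefficients. Multiplying by the indicators `χ` can only lose against the positive
parts, and the sums telescope down to the flux at level `K`. The strict loss comes from the coupling
`(δ - lam x) xⁿ (1 - x)`: when rate and tail deviate with opposite signs, this term cancels instead
of passing between positive parts. -/
theorem exists_hasDerivWithinAt_energy (h : IsTailFlow lam mu U δ s) (hlam : 0 ≤ lam)
    (hmu : 0 < mu) {x : ℝ} (hx0 : 0 < x) (hx1 : x < 1) (K : ℕ) {t : ℝ} (ht : 0 ≤ t) :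
    ∃ E', HasDerivWithinAt (energy lam mu δ s x K) E' (Ici t) t ∧
      E' ≤ lam * s (K + 1) t ∧
      (∀ n < K, 0 < δ t - lam * x → s (n + 1) t < x ^ (n + 1) →
        E' ≤ lam * s (K + 1) t - |δ t - lam * x| * (x ^ n * (1 - x))) ∧
      (∀ n < K, δ t - lam * x < 0 → x ^ (n + 1) < s (n + 1) t →
        E' ≤ lam * s (K + 1) t - |δ t - lam * x| * (x ^ n * (1 - x))) := by
  have hsub : Ici t ⊆ Ici 0 := Ici_subset_Ici.2 ht
  have hu : HasDerivWithinAt (fun t => (δ t - lam * x) / mu)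
      (lam * (s 1 t - x) - (δ t - lam * x)) (Ici t) t := by
    refine ((((h.deriv_rate t ht).mono hsub).sub_const (lam * x)).div_const mu).congr_deriv ?_
    field_simp
    ring
  have hv : ∀ n, HasDerivWithinAt (fun t => s (n + 1) t - x ^ (n + 1))
      (δ t * ((s n t - x ^ n) - (s (n + 1) t - x ^ (n + 1)))
        + (δ t - lam * x) * (x ^ n * (1 - x))
        - lam * ((s (n + 1) t - x ^ (n + 1)) - (s (n + 2) t - x ^ (n + 2)))) (Ici t) t := by
    intro n
    refine (((h.deriv n t ht).mono hsub).sub_const (x ^ (n + 1))).congr_deriv ?_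
    ring
  obtain ⟨χ₀, a0, a1, apos, aneg, ader⟩ := exists_hasDerivWithinAt_max_zero hu
  choose χ b0 b1 bpos bneg bder using fun n => exists_hasDerivWithinAt_max_zero (hv n)
  refine ⟨_, ader.add (HasDerivWithinAt.fun_sum (u := Finset.range K) fun n _ => bder n), ?_⟩
  have hmulmax : ∀ {c y : ℝ}, (0 < y → c = 1) → (y < 0 → c = 0) → c * y = max y 0 := by
    intro c y h1 h2
    rcases lt_trichotomy y 0 with hy | hy | hy
    · simp [h2 hy, hy.le]
    · simp [hy]
    · simp [h1 hy, hy.le]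
  have hmulle : ∀ {c y : ℝ}, 0 ≤ c → c ≤ 1 → c * y ≤ max y 0 := by
    intro c y h1 h2
    rcases le_total 0 y with hy | hy
    · rw [max_eq_left hy]; nlinarith
    · rw [max_eq_right hy]; nlinarith
  set v : ℕ → ℝ := fun n => s n t - x ^ n with hvdef
  have hv0 : max (v 0) 0 = 0 := by simp [hvdef, h.zero t ht]
  set w : ℕ → ℝ := fun n => x ^ n * (1 - x) with hwdef
  have hw0 : ∀ n, 0 ≤ w n := fun n => mul_nonneg (pow_nonneg hx0.le n) (sub_nonneg.2 hx1.le)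
  -- Total weight at most one: what the tails gain from `max y 0` is paid for by the term `-max y 0`
  -- of the rate equation.
  have hw1 : ∑ n ∈ Finset.range K, w n ≤ 1 := by
    have : ∑ n ∈ Finset.range K, w n = 1 - x ^ K := by
      rw [← Finset.sum_mul, mul_comm, mul_neg_geom_sum]
    rw [this]
    have := pow_nonneg hx0.le K
    linarith
  set y := δ t - lam * x with hydef
  have hδ := h.rate_nonneg t ht
  have hterm : ∀ n, χ n * (δ t * (v n - v (n + 1)) + y * w n - lam * (v (n + 1) - v (n + 2))) ≤
      δ t * (max (v n) 0 - max (v (n + 1)) 0) - lam * (max (v (n + 1)) 0 - max (v (n + 2)) 0)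
        + (max y 0 * w n - (max y 0 - χ n * y) * w n) := by
    intro n
    have e1 : χ n * v (n + 1) = max (v (n + 1)) 0 := hmulmax (bpos n) (bneg n)
    have e2 : χ n * v n ≤ max (v n) 0 := hmulle (b0 n) (b1 n)
    have e3 : χ n * v (n + 2) ≤ max (v (n + 2)) 0 := hmulle (b0 n) (b1 n)
    have e4 := mul_le_mul_of_nonneg_left e2 hδ
    have e5 := mul_le_mul_of_nonneg_left e3 hlam
    rw [← e1]
    linarith
  have hsum := Finset.sum_le_sum fun n (_ : n ∈ Finset.range K) => hterm n
  rw [Finset.sum_add_distrib, Finset.sum_sub_distrib, Finset.sum_sub_distrib, ← Finset.mul_sum,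
    ← Finset.mul_sum, ← Finset.mul_sum, Finset.sum_range_sub' (fun n => max (v n) 0),
    Finset.sum_range_sub' (fun n => max (v (n + 1)) 0), hv0] at hsum
  have hy0 : χ₀ * (lam * (s 1 t - x) - y) ≤ lam * max (v 1) 0 - max y 0 := by
    have e1 : χ₀ * y = max y 0 := by
      refine hmulmax (fun hy => apos (div_pos hy hmu)) fun hy => aneg (div_neg_of_neg_of_pos hy hmu)
    have e2 : χ₀ * v 1 ≤ max (v 1) 0 := hmulle a0 a1
    have e3 := mul_le_mul_of_nonneg_left e2 hlam
    have e4 : v 1 = s 1 t - x := by simp [hvdef]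
    rw [← e1, ← e4]
    linarith
  have hvK : max (v (K + 1)) 0 ≤ s (K + 1) t :=
    max_le (sub_le_self _ (pow_nonneg hx0.le _)) (h.nonneg _ _ ht)
  have hlast := mul_le_mul_of_nonneg_left hvK hlam
  have hK := mul_nonneg hδ (le_max_right (v K) 0)
  have hyw := mul_le_mul_of_nonneg_left hw1 (le_max_right y 0)
  have hloss : ∀ n, 0 ≤ (max y 0 - χ n * y) * w n := fun n =>
    mul_nonneg (sub_nonneg.2 (hmulle (b0 n) (b1 n))) (hw0 n)
  have main : χ₀ * (lam * (s 1 t - x) - y) + ∑ n ∈ Finset.range K,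
      χ n * (δ t * (v n - v (n + 1)) + y * w n - lam * (v (n + 1) - v (n + 2))) ≤
      lam * s (K + 1) t - ∑ n ∈ Finset.range K, (max y 0 - χ n * y) * w n := by
    simp only [zero_add] at hsum
    linarith
  refine ⟨main.trans ?_, fun n hn hy hvn => main.trans ?_, fun n hn hy hvn => main.trans ?_⟩
  · have := Finset.sum_nonneg fun n (_ : n ∈ Finset.range K) => hloss n
    linarith
  · have := Finset.single_le_sum (fun n _ => hloss n) (Finset.mem_range.2 hn)
    rw [bneg n (sub_neg.2 hvn)] at this
    rw [abs_of_pos hy]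
    rw [max_eq_left hy.le] at this ⊢
    rw [zero_mul, sub_zero] at this
    linarith
  · have := Finset.single_le_sum (fun n _ => hloss n) (Finset.mem_range.2 hn)
    rw [bpos n (sub_pos.2 hvn)] at this
    rw [abs_of_neg hy]
    rw [max_eq_right hy.le] at this ⊢
    rw [one_mul, zero_sub] at this
    linarith

end IsTailFlow

/-- The positive part of the distance between the flow and the equilibrium of parameter `x`. -/
noncomputable def totalEnergy (lam mu : ℝ) (δ : ℝ → ℝ) (s : ℕ → ℝ → ℝ) (x t : ℝ) : ℝ :=
  max ((δ t - lam * x) / mu) 0 + ∑' n, max (s (n + 1) t - x ^ (n + 1)) 0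

theorem hasSum_pow_succ {x : ℝ} (hx0 : 0 ≤ x) (hx1 : x < 1) :
    HasSum (fun n => x ^ (n + 1)) (x / (1 - x)) := by
  simpa [pow_succ', div_eq_mul_inv] using (hasSum_geometric_of_lt_one hx0 hx1).mul_left x

namespace IsTailFlow

variable {lam mu U : ℝ} {δ : ℝ → ℝ} {s : ℕ → ℝ → ℝ}

theorem max_sub_pow_le (h : IsTailFlow lam mu U δ s) {x : ℝ} (hx0 : 0 ≤ x) (n : ℕ) {t : ℝ}
    (ht : 0 ≤ t) : max (s n t - x ^ n) 0 ≤ s n t :=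
  max_le (sub_le_self _ (pow_nonneg hx0 _)) (h.nonneg _ _ ht)

theorem summable_max (h : IsTailFlow lam mu U δ s) (hlam : 0 ≤ lam) (hmu : 0 < mu) {x : ℝ}
    (hx0 : 0 ≤ x) {t : ℝ} (ht : 0 ≤ t) : Summable fun n => max (s (n + 1) t - x ^ (n + 1)) 0 :=
  Summable.of_nonneg_of_le (fun _ => le_max_right _ _) (fun _ => h.max_sub_pow_le hx0 _ ht)
    (h.hasSum_tail hlam hmu ht).summable

/-- The truncated inequality passes to the limit because the flux is at most `lam * U / (K + 1)`,
uniformly in time. The alternative `c ≤ 0` gives plain monotonicity; the bound `n < N` ensures that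
every truncation `K ≥ N` sees the strict loss. -/
theorem totalEnergy_le (h : IsTailFlow lam mu U δ s) (hlam : 0 ≤ lam) (hmu : 0 < mu) {x : ℝ}
    (hx0 : 0 < x) (hx1 : x < 1) {a b c : ℝ} {N : ℕ} (ha : 0 ≤ a) (hab : a ≤ b)
    (hc : ∀ t ∈ Ico a b, c ≤ 0 ∨ ∃ n < N, c ≤ |δ t - lam * x| * (x ^ n * (1 - x)) ∧
      (0 < δ t - lam * x ∧ s (n + 1) t < x ^ (n + 1) ∨
        δ t - lam * x < 0 ∧ x ^ (n + 1) < s (n + 1) t)) :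
    totalEnergy lam mu δ s x b ≤ totalEnergy lam mu δ s x a - c * (b - a) := by
  have key : ∀ K ≥ N, energy lam mu δ s x K b ≤
      energy lam mu δ s x K a + (lam * (U / (K + 1)) - c) * (b - a) := by
    intro K hK
    choose! E' hE' hle hpos hneg using fun t (ht : 0 ≤ t) =>
      h.exists_hasDerivWithinAt_energy hlam hmu hx0 hx1 K ht
    have hcont : ContinuousOn (energy lam mu δ s x K) (Icc a b) := by
      have hδ : ContinuousOn δ (Icc a b) := fun y hy =>
        (h.deriv_rate y (ha.trans hy.1)).continuousWithinAt.mono fun z hz => ha.trans hz.1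
      have hs : ∀ n, ContinuousOn (s (n + 1)) (Icc a b) := fun n y hy =>
        (h.deriv n y (ha.trans hy.1)).continuousWithinAt.mono fun z hz => ha.trans hz.1
      exact (((hδ.sub continuousOn_const).div_const mu).sup continuousOn_const).add
        (continuousOn_finsetSum _ fun n _ => ((hs n).sub continuousOn_const).sup continuousOn_const)
    refine image_le_of_deriv_right_le_deriv_boundary (f := energy lam mu δ s x K)
      (B := fun t => energy lam mu δ s x K a + (lam * (U / (K + 1)) - c) * (t - a))
      (B' := fun _ => lam * (U / (K + 1)) - c) hcont
      (fun y hy => hE' y (ha.trans hy.1)) (by simp) (by fun_prop)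
      (fun y _ => ?_) (fun y hy => ?_) ⟨hab, le_rfl⟩
    · simpa using (((hasDerivWithinAt_id y (Ici y)).sub_const a).const_mul
        (lam * (U / (K + 1)) - c)).const_add (energy lam mu δ s x K a)
    · have hy0 := ha.trans hy.1
      have hl := mul_le_mul_of_nonneg_left (h.tail_le hlam hmu K hy0) hlam
      rcases hc y hy with h0 | ⟨n, hn, hcn, ⟨h1, h2⟩ | ⟨h1, h2⟩⟩
      · linarith [hle y hy0]
      · linarith [hpos y hy0 n (hn.trans_le hK) h1 h2]
      · linarith [hneg y hy0 n (hn.trans_le hK) h1 h2]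
  have hlim : ∀ t, 0 ≤ t → Tendsto (fun K => energy lam mu δ s x K t) atTop
      (𝓝 (totalEnergy lam mu δ s x t)) := fun t ht =>
    (h.summable_max hlam hmu hx0.le ht).hasSum.tendsto_sum_nat.const_add _
  have hU : Tendsto (fun K : ℕ => U / ((K : ℝ) + 1)) atTop (𝓝 0) := by
    simpa [Function.comp_def] using
      (tendsto_const_div_atTop_nhds_zero_nat U).comp (tendsto_add_atTop_nat 1)
  have hR := (hlim a ha).add (((hU.const_mul lam).sub_const c).mul_const (b - a))
  refine le_of_tendsto_of_tendsto (hlim b (ha.trans hab)) (hR.trans_eq ?_)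
    (eventually_atTop.2 ⟨N, key⟩)
  congr 1
  ring

/-- The tails are summable uniformly in time. -/
theorem exists_tsum_tail_le (h : IsTailFlow lam mu U δ s) (hlam : 0 ≤ lam) (hmu : 0 < mu)
    {ε : ℝ} (hε : 0 < ε) : ∃ N : ℕ, ∀ t, 0 ≤ t → ∑' n, s (n + N + 1) t ≤ ε := by
  -- Here `x` is free: energies decrease even if the equilibrium does not have mass `U`. As `x → 1`
  -- the initial energy tends to `0` by dominated convergence, since `s ≤ 1`; later tails then
  -- exceed those of a geometric sequence by at most `ε / 2`.
  have hlim : Tendsto (fun x : ℝ => ∑' n, max (s (n + 1) 0 - x ^ (n + 1)) 0) (𝓝[<] 1)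
      (𝓝 (∑' _ : ℕ, (0 : ℝ))) := by
    refine tendsto_tsum_of_dominated_convergence h.hasSum.summable (fun n => ?_) ?_
    · have hc : Continuous fun x : ℝ => max (s (n + 1) 0 - x ^ (n + 1)) 0 := by fun_prop
      refine ((hc.tendsto 1).mono_left nhdsWithin_le_nhds).trans_eq ?_
      rw [one_pow, max_eq_right (sub_nonpos.2 (h.le_one _ le_rfl))]
    · filter_upwards [Ioo_mem_nhdsLT (zero_lt_one (α := ℝ))] with x hx n
      rw [Real.norm_of_nonneg (le_max_right _ _)]
      exact h.max_sub_pow_le hx.1.le _ le_rfl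
  rw [tsum_zero] at hlim
  obtain ⟨x, hxε, hx⟩ := ((hlim.eventually (gt_mem_nhds (half_pos hε))).and
    (Ioo_mem_nhdsLT (zero_lt_one (α := ℝ)))).exists
  have hE0 : totalEnergy lam mu δ s x 0 < ε / 2 := by
    have : (δ 0 - lam * x) / mu ≤ 0 := by
      rw [h.rate_zero, zero_sub]
      exact div_nonpos_of_nonpos_of_nonneg (neg_nonpos.2 (mul_nonneg hlam hx.1.le)) hmu.le
    rw [totalEnergy, max_eq_right this, zero_add]
    exact hxε
  have hpow := hasSum_pow_succ hx.1.le hx.2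
  obtain ⟨N, hN⟩ := ((tendsto_sum_nat_add fun n => x ^ (n + 1)).eventually
    (gt_mem_nhds (half_pos hε))).exists
  refine ⟨N, fun t ht => ?_⟩
  have hE := h.totalEnergy_le hlam hmu hx.1 hx.2 (c := 0) (N := 0) le_rfl ht
    fun _ _ => Or.inl le_rfl
  have hsm := h.summable_max hlam hmu hx.1.le ht
  have hs1 : Summable fun n => x ^ (n + N + 1) := (summable_nat_add_iff N).2 hpow.summable
  have hs2 : Summable fun n => max (s (n + N + 1) t - x ^ (n + N + 1)) 0 :=
    (summable_nat_add_iff (f := fun n => max (s (n + 1) t - x ^ (n + 1)) 0) N).2 hsm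
  have hle : ∑' n, s (n + N + 1) t ≤
      ∑' n, (x ^ (n + N + 1) + max (s (n + N + 1) t - x ^ (n + N + 1)) 0) := by
    refine Summable.tsum_le_tsum (fun n => ?_)
      ((summable_nat_add_iff N).2 (h.hasSum_tail hlam hmu ht).summable) (hs1.add hs2)
    linarith [le_max_left (s (n + N + 1) t - x ^ (n + N + 1)) 0]
  rw [hs1.tsum_add hs2] at hle
  have hsplit := hsm.sum_add_tsum_nat_add N
  have hfin : 0 ≤ ∑ n ∈ Finset.range N, max (s (n + 1) t - x ^ (n + 1)) 0 :=
    Finset.sum_nonneg fun n _ => le_max_right _ _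
  have hE1 : ∑' n, max (s (n + 1) t - x ^ (n + 1)) 0 ≤ totalEnergy lam mu δ s x t :=
    le_add_of_nonneg_left (le_max_right _ _)
  linarith

/-- Flow and equilibrium have the same mass, so the deviations of the tails sum to `-(δ t - lam * x)
/ mu`, of size at least `ε / mu`. The indices beyond `N` account for at most half of this, uniformly
in time, so some index below `N` has the opposite sign. -/
theorem exists_opposite_sign (h : IsTailFlow lam mu U δ s) (hlam : 0 ≤ lam) (hmu : 0 < mu)
    {x : ℝ} (hx0 : 0 < x) (hx1 : x < 1) (hxU : lam / mu * x + x / (1 - x) = U)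
    {ε : ℝ} (hε : 0 < ε) : ∃ N : ℕ, ∀ t, 0 ≤ t → ε ≤ |δ t - lam * x| → ∃ n < N,
      (0 < δ t - lam * x ∧ s (n + 1) t < x ^ (n + 1) ∨
        δ t - lam * x < 0 ∧ x ^ (n + 1) < s (n + 1) t) := by
  have hε' : 0 < ε / mu / 2 := by positivity
  obtain ⟨N₁, hN₁⟩ := h.exists_tsum_tail_le hlam hmu hε'
  obtain ⟨N₂, hN₂⟩ := eventually_atTop.1 ((tendsto_sum_nat_add fun n => x ^ (n + 1)).eventually
    (gt_mem_nhds hε'))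
  have hpow := hasSum_pow_succ hx0.le hx1
  refine ⟨N₁ + N₂, fun t ht hεt => ?_⟩
  have hs := h.hasSum_tail hlam hmu ht
  have htail : ∑' n, s (n + (N₁ + N₂) + 1) t ≤ ε / mu / 2 := by
    refine le_trans ?_ (hN₁ t ht)
    refine Summable.tsum_le_tsum (fun n => h.antitone ht (by omega)) ?_ ?_
    · exact (summable_nat_add_iff (f := fun n => s (n + 1) t) _).2 hs.summable
    · exact (summable_nat_add_iff (f := fun n => s (n + 1) t) _).2 hs.summable
  have hptail := hN₂ (N₁ + N₂) (Nat.le_add_left _ _)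
  set N := N₁ + N₂
  have hs' := (hasSum_nat_add_iff' N).2 hs
  have hpow' := (hasSum_nat_add_iff' N).2 hpow
  have hs0 := hs'.nonneg fun n => h.nonneg _ t ht
  have hp0 := hpow'.nonneg fun n => pow_nonneg hx0.le _
  rw [hs'.tsum_eq] at htail
  rw [hpow'.tsum_eq] at hptail
  have hy : (δ t - lam * x) / mu = δ t / mu - lam / mu * x := by ring
  by_contra! hcon
  rcases lt_or_ge 0 (δ t - lam * x) with hpos | hneg
  · have hsum : ∑ n ∈ Finset.range N, x ^ (n + 1) ≤ ∑ n ∈ Finset.range N, s (n + 1) t :=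
      Finset.sum_le_sum fun n hn => (hcon n (Finset.mem_range.1 hn)).1 hpos
    rw [abs_of_pos hpos] at hεt
    have := div_le_div_of_nonneg_right hεt hmu.le
    linarith
  · have hneg' : δ t - lam * x < 0 := by
      refine hneg.lt_of_ne fun h0 => ?_
      rw [h0, abs_zero] at hεt
      exact absurd hε hεt.not_gt
    have hsum : ∑ n ∈ Finset.range N, s (n + 1) t ≤ ∑ n ∈ Finset.range N, x ^ (n + 1) :=
      Finset.sum_le_sum fun n hn => (hcon n (Finset.mem_range.1 hn)).2 hneg'
    rw [abs_of_neg hneg'] at hεt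
    have := div_le_div_of_nonneg_right hεt hmu.le
    rw [neg_div] at this
    linarith

theorem abs_rate_sub_le (h : IsTailFlow lam mu U δ s) (hlam : 0 ≤ lam) (hmu : 0 < mu) {a b : ℝ}
    (ha : 0 ≤ a) (hab : a ≤ b) : |δ b - δ a| ≤ (lam * mu + mu * (mu * U)) * (b - a) := by
  refine norm_image_sub_le_of_norm_deriv_le_segment'
    (fun y hy => (h.deriv_rate y (ha.trans hy.1)).mono fun z hz => ha.trans hz.1)
    (fun y hy => ?_) b ⟨hab, le_rfl⟩
  have hy0 := ha.trans hy.1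
  have h1 := mul_le_mul_of_nonneg_left (h.le_one 1 hy0) (mul_nonneg hlam hmu.le)
  have h2 := mul_le_mul_of_nonneg_left (h.rate_le hlam hmu hy0) hmu.le
  have h3 := mul_nonneg (mul_nonneg hlam hmu.le) (h.nonneg 1 y hy0)
  have h4 := mul_nonneg hmu.le (h.rate_nonneg y hy0)
  rw [Real.norm_eq_abs, abs_le]
  constructor <;> linarith

/-- Convergence of the arrival rate to its equilibrium value. -/
theorem tendsto_rate (h : IsTailFlow lam mu U δ s) (hlam : 0 ≤ lam) (hmu : 0 < mu)
    {x : ℝ} (hx0 : 0 < x) (hx1 : x < 1) (hxU : lam / mu * x + x / (1 - x) = U) :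
    Tendsto δ atTop (𝓝 (lam * x)) := by
  set E := totalEnergy lam mu δ s x with hE
  have hanti : ∀ a b, 0 ≤ a → a ≤ b → E b ≤ E a := fun a b ha hab => by
    simpa using h.totalEnergy_le hlam hmu hx0 hx1 (c := 0) (N := 0) ha hab fun _ _ => Or.inl le_rfl
  have hE0 : ∀ t, 0 ≤ E t := fun t =>
    add_nonneg (le_max_right _ _) (tsum_nonneg fun n => le_max_right _ _)
  obtain ⟨l, hl⟩ : ∃ l, Tendsto E atTop (𝓝 l) := by
    have hmono : Antitone fun t => E (max t 0) := fun a b hab =>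
      hanti _ _ (le_max_right _ _) (max_le_max_right 0 hab)
    refine ⟨_, (tendsto_atTop_ciInf hmono ⟨0, ?_⟩).congr' ?_⟩
    · rintro _ ⟨t, rfl⟩
      exact hE0 _
    · filter_upwards [eventually_ge_atTop 0] with t ht
      rw [max_eq_left ht]
  have hU : 0 < U := by
    rw [← hxU]
    have := sub_pos.2 hx1
    positivity
  have hL : 0 < lam * mu + mu * (mu * U) := by positivity
  set L := lam * mu + mu * (mu * U)
  rw [Metric.tendsto_atTop]
  intro ε hε
  obtain ⟨N, hN⟩ := h.exists_opposite_sign hlam hmu hx0 hx1 hxU (half_pos hε)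
  have hx1' := sub_pos.2 hx1
  -- `c` bounds the loss rate from below for all `n < N` while the deviation is at least `ε / 2`.
  -- The time `η` is so short that the rate moves by at most `ε / 2`, so a deviation `ε` at `t`
  -- costs energy `c * η` on `[t, t + η]`.
  set c := ε / 2 * (x ^ N * (1 - x)) with hc
  have hcpos : 0 < c := by positivity
  set η := ε / 2 / L with hη
  have hηpos : 0 < η := by positivity
  have hdiff : Tendsto (fun t => E t - E (t + η)) atTop (𝓝 0) := by
    simpa using hl.sub (hl.comp (tendsto_atTop_add_const_right atTop η tendsto_id))
  obtain ⟨T, hT⟩ := eventually_atTop.1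
    ((hdiff.eventually (gt_mem_nhds (mul_pos hcpos hηpos))).and (eventually_ge_atTop 0))
  refine ⟨T, fun t htT => ?_⟩
  obtain ⟨hlt, ht0⟩ := hT t htT
  by_contra! hge
  rw [Real.dist_eq] at hge
  have hdrop := h.totalEnergy_le hlam hmu hx0 hx1 (a := t) (b := t + η) (c := c) (N := N) ht0
    (by linarith) fun r hr => Or.inr ?_
  · rw [add_sub_cancel_left] at hdrop
    linarith
  · have hr0 := ht0.trans hr.1
    have h1 := h.abs_rate_sub_le hlam hmu ht0 hr.1
    have h2 : L * (r - t) ≤ ε / 2 := by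
      have : L * (r - t) ≤ L * η := mul_le_mul_of_nonneg_left (by linarith [hr.2]) hL.le
      rwa [hη, mul_div_cancel₀ _ hL.ne'] at this
    have h3 : |δ t - lam * x| ≤ |δ r - lam * x| + |δ r - δ t| := by
      rw [← abs_neg (δ r - δ t)]
      refine (le_of_eq ?_).trans (abs_add_le _ _)
      congr 1
      ring
    have h4 : ε / 2 ≤ |δ r - lam * x| := by linarith
    obtain ⟨n, hn, hsign⟩ := hN r hr0 h4
    refine ⟨n, hn, ?_, hsign⟩
    have h5 : x ^ N ≤ x ^ n := pow_le_pow_of_le_one hx0.le hx1.le hn.le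
    rw [hc]
    gcongr

end IsTailFlow

/-- Abel summation; the boundary term, `K` times the mass on `[K, ∞)`, is at most the remainder
`∑_{k ≥ K} k p k` of the mean. -/
theorem hasSum_tails_of_hasSum_mul {p : ℕ → ℝ} {U : ℝ} (hp : ∀ k, 0 ≤ p k) (hp1 : HasSum p 1)
    (hpU : HasSum (fun k : ℕ => (k : ℝ) * p k) U) :
    HasSum (fun n => 1 - ∑ k ∈ Finset.range (n + 1), p k) U := by
  have hnn : ∀ n, 0 ≤ 1 - ∑ k ∈ Finset.range n, p k := fun n =>
    sub_nonneg.2 (sum_le_hasSum _ (fun k _ => hp k) hp1)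
  rw [hasSum_iff_tendsto_nat_of_nonneg fun n => hnn _]
  have habel : ∀ K : ℕ, ∑ n ∈ Finset.range K, (1 - ∑ k ∈ Finset.range (n + 1), p k) =
      K * (1 - ∑ k ∈ Finset.range K, p k) + ∑ k ∈ Finset.range K, (k : ℝ) * p k := by
    intro K
    induction K with
    | zero => simp
    | succ K ih =>
      rw [Finset.sum_range_succ, ih, Finset.sum_range_succ p, Finset.sum_range_succ fun k => _ * _]
      push_cast
      ring
  have hle : ∀ K : ℕ, K * (1 - ∑ k ∈ Finset.range K, p k) ≤
      U - ∑ k ∈ Finset.range K, (k : ℝ) * p k := by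
    intro K
    refine hasSum_le (fun n => ?_) (((hasSum_nat_add_iff' K).2 hp1).mul_left (K : ℝ))
      ((hasSum_nat_add_iff' K).2 hpU)
    have := hp (n + K)
    push_cast
    nlinarith [mul_nonneg (Nat.cast_nonneg (α := ℝ) n) this]
  have hlim := hpU.tendsto_sum_nat
  refine tendsto_of_tendsto_of_tendsto_of_le_of_le hlim tendsto_const_nhds (fun K => ?_) fun K => ?_
  · rw [habel]
    exact le_add_of_nonneg_left (mul_nonneg (Nat.cast_nonneg K) (hnn K))
  · rw [habel]
    linarith [hle K]

theorem IsQueueLaw.isTailFlow {lam mu U : ℝ} {p : ℕ → ℝ} {δ : ℝ → ℝ} {q : ℕ → ℝ → ℝ}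
    (hq : IsQueueLaw lam p δ q) (hp : ∀ k, 0 ≤ p k) (hp1 : HasSum p 1)
    (hpU : HasSum (fun k : ℕ => (k : ℝ) * p k) U) (hδ0 : δ 0 = 0) (hδ : ∀ t, 0 ≤ t → 0 ≤ δ t)
    (hδ' : ∀ t, 0 ≤ t →
      HasDerivWithinAt δ (lam * mu * (1 - q 0 t) - mu * δ t) (Ici 0) t) :
    IsTailFlow lam mu U δ fun n t => 1 - ∑ k ∈ Finset.range n, q k t where
  zero t _ := by simp
  succ_le n t ht := by
    rw [Finset.sum_range_succ]
    linarith [hq.nonneg n t ht]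
  nonneg n t ht :=
    sub_nonneg.2 (sum_le_hasSum _ (fun k _ => hq.nonneg k t ht) (hq.hasSum_one t ht))
  rate_zero := hδ0
  rate_nonneg := hδ
  deriv_rate t ht := by simpa using hδ' t ht
  deriv n t ht := by
    have key : HasDerivWithinAt (fun t => ∑ k ∈ Finset.range (n + 1), q k t)
        (lam * q (n + 1) t - δ t * q n t) (Ici 0) t := by
      induction n with
      | zero => simpa [sub_eq_neg_add] using hq.deriv_zero t ht
      | succ n ih =>
        simp only [Finset.sum_range_succ _ (n + 1)]
        refine (ih.add (hq.deriv_succ n t ht)).congr_deriv ?_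
        ring
    refine (key.const_sub 1).congr_deriv ?_
    rw [Finset.sum_range_succ _ (n + 1), Finset.sum_range_succ _ n]
    ring
  hasSum := by
    simp only [hq.initial]
    exact hasSum_tails_of_hasSum_mul hp hp1 hpU

/-! ### Global flows in a bounded closed convex set -/

section GlobalSolution

variable {E : Type*} [NormedAddCommGroup E] [NormedSpace ℝ E]

/-- The weights `exp (-t)` at `x₀` and `exp (s - t) ds` on `[0, t]` have total mass one, so the
vector is an average of points of `S`. A separating functional reduces this to a scalar inequality.
-/
theorem exp_average_mem [CompleteSpace E] {S : Set E} (hconv : Convex ℝ S) (hclosed : IsClosed S)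
    {x₀ : E} (hx₀ : x₀ ∈ S) {y : ℝ → E} (hy : Continuous y) (hyS : ∀ s, y s ∈ S) {t : ℝ}
    (ht : 0 ≤ t) :
    Real.exp (-t) • (x₀ + ∫ s in (0 : ℝ)..t, Real.exp s • y s) ∈ S := by
  by_contra hnot
  obtain ⟨f, u, hfu, hu⟩ := geometric_hahn_banach_closed_point hconv hclosed hnot
  have hcont : Continuous fun s => Real.exp s • y s := Real.continuous_exp.smul hy
  have h1 : f (∫ s in (0 : ℝ)..t, Real.exp s • y s) = ∫ s in (0 : ℝ)..t, Real.exp s * f (y s) := by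
    rw [← f.intervalIntegral_comp_comm (hcont.intervalIntegrable 0 t)]
    simp
  have h2 : ∫ s in (0 : ℝ)..t, Real.exp s * f (y s) ≤ ∫ s in (0 : ℝ)..t, Real.exp s * u := by
    refine intervalIntegral.integral_mono_on ht ?_ ?_ fun s _ =>
      mul_le_mul_of_nonneg_left (hfu _ (hyS s)).le (Real.exp_pos s).le
    · exact (Real.continuous_exp.mul (f.continuous.comp hy)).intervalIntegrable 0 t
    · exact (Real.continuous_exp.mul continuous_const).intervalIntegrable 0 t
  rw [intervalIntegral.integral_mul_const, integral_exp, Real.exp_zero] at h2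
  rw [map_smul, map_add, h1, smul_eq_mul] at hu
  have h3 := hfu _ hx₀
  have h4 : Real.exp (-t) * (f x₀ + ∫ s in (0 : ℝ)..t, Real.exp s * f (y s)) ≤
      Real.exp (-t) * (Real.exp t * u) :=
    mul_le_mul_of_nonneg_left (by linarith) (Real.exp_pos _).le
  rw [← mul_assoc, ← Real.exp_add, neg_add_cancel, Real.exp_zero, one_mul] at h4
  linarith

/-- The path with exponentially weighted values `y`. -/
noncomputable def weightedPath (L : ℝ≥0) (y : ℝ≥0 →ᵇ E) (s : ℝ) : E :=
  Real.exp (L * (s.toNNReal : ℝ)) • y s.toNNReal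

theorem continuous_weightedPath (L : ℝ≥0) (y : ℝ≥0 →ᵇ E) : Continuous (weightedPath L y) := by
  have h : Continuous fun s : ℝ => s.toNNReal := continuous_real_toNNReal
  unfold weightedPath
  fun_prop

/-- The Duhamel map of the equation `x' = g x - x`. -/
noncomputable def duhamel (g : E → E) (x₀ : E) (x : ℝ → E) (t : ℝ) : E :=
  Real.exp (-t) • (x₀ + ∫ s in (0 : ℝ)..t, Real.exp s • g (x s))

theorem hasDerivAt_duhamel [CompleteSpace E] {g : E → E} {x₀ : E} {x : ℝ → E}
    (hgx : Continuous fun s => g (x s)) (t : ℝ) :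
    HasDerivAt (duhamel g x₀ x) (g (x t) - duhamel g x₀ x t) t := by
  have hcont : Continuous fun s => Real.exp s • g (x s) := Real.continuous_exp.smul hgx
  have h1 := (hcont.integral_hasStrictDerivAt 0 t).hasDerivAt.const_add x₀
  have h2 : HasDerivAt (fun t : ℝ => Real.exp (-t)) (-Real.exp (-t)) t := by
    simpa using (hasDerivAt_neg t).exp
  refine (h2.smul h1).congr_deriv ?_
  rw [smul_smul, ← Real.exp_add, neg_add_cancel, Real.exp_zero, one_smul, duhamel, neg_smul]
  abel

/-- The factor `L / (L + 1)` comes from `∫₀ᵗ exp (-(t - s)) L exp (L s) ds ≤ L / (L + 1) * exp (L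
t)`; it makes the Duhamel map a contraction in the weighted norm. -/
theorem norm_duhamel_sub_le [CompleteSpace E] {S : Set E} {g : E → E} {L : ℝ≥0}
    (hg : LipschitzOnWith L g S) (x₀ : E) {x y : ℝ → E} (hx : Continuous x) (hy : Continuous y)
    (hxS : ∀ s, x s ∈ S) (hyS : ∀ s, y s ∈ S) {d : ℝ} {t : ℝ} (ht : 0 ≤ t)
    (hd : ∀ s, 0 ≤ s → ‖x s - y s‖ ≤ Real.exp (L * s) * d) (hd0 : 0 ≤ d) :
    ‖duhamel g x₀ x t - duhamel g x₀ y t‖ ≤ Real.exp (L * t) * (L / (L + 1) * d) := by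
  have hgx : Continuous fun s => g (x s) := hg.continuousOn.comp_continuous hx hxS
  have hgy : Continuous fun s => g (y s) := hg.continuousOn.comp_continuous hy hyS
  have hint : ∀ {z : ℝ → E}, Continuous z →
      IntervalIntegrable (fun s => Real.exp s • z s) MeasureTheory.volume 0 t := fun hz =>
    (Real.continuous_exp.smul hz).intervalIntegrable 0 t
  have hL : (0 : ℝ) < L + 1 := by positivity
  have heq : duhamel g x₀ x t - duhamel g x₀ y t =
      Real.exp (-t) • ∫ s in (0 : ℝ)..t, Real.exp s • (g (x s) - g (y s)) := by
    simp only [smul_sub]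
    rw [intervalIntegral.integral_sub (hint hgx) (hint hgy), duhamel, duhamel, ← smul_sub,
      add_sub_add_left_eq_sub]
  have hprim : ∀ s : ℝ, HasDerivAt (fun s : ℝ => Real.exp ((L + 1) * s) * (L / (L + 1) * d))
      (Real.exp ((L + 1) * s) * (L * d)) s := by
    intro s
    have := (((hasDerivAt_id s).const_mul ((L : ℝ) + 1)).exp).mul_const (L / (L + 1) * d)
    refine this.congr_deriv ?_
    simp only [id, mul_one]
    field_simp
  have hbound : ‖∫ s in (0 : ℝ)..t, Real.exp s • (g (x s) - g (y s))‖ ≤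
      ∫ s in (0 : ℝ)..t, Real.exp ((L + 1) * s) * (L * d) := by
    refine intervalIntegral.norm_integral_le_of_norm_le ht
      (MeasureTheory.ae_of_all _ fun s hs => ?_) ?_
    · rw [norm_smul, Real.norm_of_nonneg (Real.exp_pos s).le, add_mul, one_mul, Real.exp_add,
        mul_comm (Real.exp (L * s)), mul_assoc]
      refine mul_le_mul_of_nonneg_left ?_ (Real.exp_pos s).le
      refine (hg.norm_sub_le (hxS s) (hyS s)).trans ?_
      have := mul_le_mul_of_nonneg_left (hd s hs.1.le) L.coe_nonneg
      linarith
    · exact (by fun_prop : Continuous fun s : ℝ =>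
        Real.exp (((L : ℝ) + 1) * s) * (L * d)).intervalIntegrable 0 t
  rw [intervalIntegral.integral_eq_sub_of_hasDerivAt (fun s _ => hprim s)
    ((by fun_prop : Continuous fun s : ℝ =>
        Real.exp (((L : ℝ) + 1) * s) * (L * d)).intervalIntegrable 0 t)] at hbound
  rw [heq, norm_smul, Real.norm_of_nonneg (Real.exp_pos _).le]
  have h0 : 0 ≤ Real.exp ((L + 1) * 0) * (L / (L + 1) * d) := by positivity
  calc Real.exp (-t) * ‖∫ s in (0 : ℝ)..t, Real.exp s • (g (x s) - g (y s))‖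
      ≤ Real.exp (-t) * (Real.exp ((L + 1) * t) * (L / (L + 1) * d)) :=
        mul_le_mul_of_nonneg_left (by linarith) (Real.exp_pos _).le
    _ = Real.exp (L * t) * (L / (L + 1) * d) := by
        rw [← mul_assoc, ← Real.exp_add]
        congr 2
        ring

/-- A self-map `g` of a bounded closed convex set, Lipschitz there, drives a global solution of
`x' = g x - x` that stays in the set. -/
theorem exists_global_solution [CompleteSpace E] {S : Set E} (hconv : Convex ℝ S)
    (hclosed : IsClosed S) (hbdd : Bornology.IsBounded S) {g : E → E} {L : ℝ≥0}
    (hg : LipschitzOnWith L g S) (hgS : MapsTo g S S) {x₀ : E} (hx₀ : x₀ ∈ S) :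
    ∃ x : ℝ → E, x 0 = x₀ ∧ ∀ t, 0 ≤ t → x t ∈ S ∧
      HasDerivWithinAt x (g (x t) - x t) (Ici 0) t := by
  obtain ⟨R, hR⟩ := hbdd.exists_norm_le
  have hR0 : 0 ≤ R := (norm_nonneg _).trans (hR _ hx₀)
  have hexp : ∀ t : ℝ≥0, Real.exp (-(L * (t : ℝ))) ≤ 1 := fun t =>
    Real.exp_le_one_iff.2 (neg_nonpos.2 (mul_nonneg L.coe_nonneg t.coe_nonneg))
  have hcancel : ∀ a : ℝ, Real.exp a * Real.exp (-a) = 1 := fun a => by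
    rw [← Real.exp_add, add_neg_cancel, Real.exp_zero]
  -- An element of `T` is a path in `S` damped by `exp (-(L t))`, so the sup distance is the
  -- weighted distance in which Duhamel contracts on the whole half-line at once.
  let T : Set (ℝ≥0 →ᵇ E) := {y | ∀ t : ℝ≥0, Real.exp (L * (t : ℝ)) • y t ∈ S}
  have hTclosed : IsClosed T := by
    simp only [T, ofPred_forall]
    refine isClosed_iInter fun t => hclosed.preimage ?_
    exact (continuous_eval_const t).const_smul _
  have hpath : ∀ y ∈ T, ∀ s, weightedPath L y s ∈ S := fun y hy s => hy _
  have hgpath : ∀ y ∈ T, Continuous fun s => g (weightedPath L y s) := fun y hy =>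
    hg.continuousOn.comp_continuous (continuous_weightedPath L y) (hpath y hy)
  have hmem : ∀ y ∈ T, ∀ t : ℝ≥0, duhamel g x₀ (weightedPath L y) t ∈ S := fun y hy t =>
    exp_average_mem hconv hclosed hx₀ (hgpath y hy) (fun s => hgS (hpath y hy s)) t.coe_nonneg
  let F : T → ℝ≥0 →ᵇ E := fun y => BoundedContinuousFunction.ofNormedAddCommGroup
    (fun t : ℝ≥0 => Real.exp (-(L * (t : ℝ))) • duhamel g x₀ (weightedPath L y.1) t)
    (by
      have : Continuous (duhamel g x₀ (weightedPath L y.1)) :=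
        continuous_iff_continuousAt.2 fun t =>
          (hasDerivAt_duhamel (hgpath y.1 y.2) t).continuousAt
      fun_prop) R
    (fun t => by
      rw [norm_smul, Real.norm_of_nonneg (Real.exp_pos _).le]
      exact (mul_le_mul (hexp t) (hR _ (hmem y.1 y.2 t)) (norm_nonneg _) zero_le_one).trans_eq
        (one_mul R))
  have hF : ∀ (y : T) (t : ℝ≥0), F y t =
      Real.exp (-(L * (t : ℝ))) • duhamel g x₀ (weightedPath L y.1) t := fun _ _ => rfl
  have hFapply : ∀ (y : T) (t : ℝ≥0), Real.exp (L * (t : ℝ)) • F y t =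
      duhamel g x₀ (weightedPath L y.1) t := fun y t => by
    rw [hF, smul_smul, hcancel, one_smul]
  let Φ : T → T := fun y => ⟨F y, fun t => by rw [hFapply]; exact hmem y.1 y.2 t⟩
  have hΦ : ContractingWith (L / (L + 1)) Φ := by
    refine ⟨(div_lt_one (by positivity)).2 (lt_add_one L), LipschitzWith.of_dist_le_mul
      fun y z => ?_⟩
    change dist (F y) (F z) ≤ _
    rw [BoundedContinuousFunction.dist_le (by positivity)]
    intro t
    have hdist : ∀ s, 0 ≤ s → ‖weightedPath L y.1 s - weightedPath L z.1 s‖ ≤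
        Real.exp (L * s) * dist y z := by
      intro s hs
      rw [weightedPath, weightedPath, ← smul_sub, norm_smul, Real.norm_of_nonneg (Real.exp_pos _).le,
        Real.coe_toNNReal s hs, ← dist_eq_norm]
      exact mul_le_mul_of_nonneg_left (BoundedContinuousFunction.dist_coe_le_dist _)
        (Real.exp_pos _).le
    have key := norm_duhamel_sub_le hg x₀ (continuous_weightedPath L y.1)
      (continuous_weightedPath L z.1) (hpath _ y.2) (hpath _ z.2) t.coe_nonneg hdist dist_nonneg
    rw [hF, hF, dist_eq_norm, ← smul_sub, norm_smul, Real.norm_of_nonneg (Real.exp_pos _).le]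
    refine (mul_le_mul_of_nonneg_left key (Real.exp_pos _).le).trans_eq ?_
    rw [← mul_assoc, mul_comm (Real.exp (-_)), hcancel, one_mul]
    simp
  have : CompleteSpace T := hTclosed.completeSpace_coe
  have : Nonempty T := by
    refine ⟨⟨BoundedContinuousFunction.ofNormedAddCommGroup
      (fun t : ℝ≥0 => Real.exp (-(L * (t : ℝ))) • x₀) (by fun_prop) R fun t => ?_, fun t => ?_⟩⟩
    · rw [norm_smul, Real.norm_of_nonneg (Real.exp_pos _).le]
      exact (mul_le_mul (hexp t) (hR _ hx₀) (norm_nonneg _) zero_le_one).trans_eq (one_mul R)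
    · change Real.exp (L * (t : ℝ)) • (Real.exp (-(L * (t : ℝ))) • x₀) ∈ S
      rwa [smul_smul, hcancel, one_smul]
  set y := hΦ.fixedPoint with hy
  have hfix : Φ y = y := hΦ.fixedPoint_isFixedPt
  have heq : ∀ t, 0 ≤ t → weightedPath L y.1 t = duhamel g x₀ (weightedPath L y.1) t := by
    intro t ht
    have := hFapply y t.toNNReal
    rw [Real.coe_toNNReal t ht] at this
    rw [← this, weightedPath, Real.coe_toNNReal t ht]
    congr 2
    exact congrArg Subtype.val hfix.symm
  refine ⟨weightedPath L y.1, ?_, fun t ht => ⟨hpath _ y.2 t, ?_⟩⟩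
  · rw [heq 0 le_rfl]
    simp [duhamel]
  · rw [heq t ht]
    have h1 := (hasDerivAt_duhamel (x₀ := x₀) (hgpath y.1 y.2) t).hasDerivWithinAt (s := Ici 0)
    rw [← heq t ht] at h1 ⊢
    exact h1.congr heq (heq t ht)

end GlobalSolution

/-! ### The nonlinear Kolmogorov system on `ℝ × ℓ¹` -/

theorem summable_lp_one (q : ℓ¹(ℕ, ℝ)) : Summable fun n => |q n| := by
  simpa using (lp.memℓp q).summable (by simp)

theorem norm_lp_one (q : ℓ¹(ℕ, ℝ)) : ‖q‖ = ∑' n, |q n| := by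
  have h := lp.hasSum_norm (p := 1) (by simp) q
  simp only [ENNReal.toReal_one, Real.rpow_one, Real.norm_eq_abs] at h
  exact h.tsum_eq.symm

/-- A summable sequence as an element of `ℓ¹`. -/
def lpOfSummable (f : ℕ → ℝ) (hf : Summable fun n => |f n|) : ℓ¹(ℕ, ℝ) :=
  ⟨f, memℓp_gen (by simpa using hf)⟩

theorem lp_add_apply (q q' : ℓ¹(ℕ, ℝ)) (n : ℕ) : (q + q') n = q n + q' n := rfl

theorem lp_smul_apply (c : ℝ) (q : ℓ¹(ℕ, ℝ)) (n : ℕ) : (c • q) n = c * q n := rfl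

/-- The sequence `0, f 0, f 1, …`. -/
def consZero (f : ℕ → ℝ) : ℕ → ℝ
  | 0 => 0
  | n + 1 => f n

theorem summable_abs_consZero {f : ℕ → ℝ} (hf : Summable fun n => |f n|) :
    Summable fun n => |consZero f n| := (summable_nat_add_iff 1).1 hf

/-- The right shift on `ℓ¹`. -/
noncomputable def shiftRight : ℓ¹(ℕ, ℝ) →L[ℝ] ℓ¹(ℕ, ℝ) :=
  LinearMap.mkContinuous
    { toFun := fun q => lpOfSummable (consZero q) (summable_abs_consZero (summable_lp_one q))
      map_add' := fun q q' => by
        ext n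
        rw [lp_add_apply]
        cases n
        · exact (add_zero 0).symm
        · rfl
      map_smul' := fun c q => by
        ext n
        rw [lp_smul_apply]
        cases n
        · exact (mul_zero _).symm
        · rfl }
    1 fun q => by
      rw [one_mul, norm_lp_one, norm_lp_one]
      refine ((summable_abs_consZero (summable_lp_one q)).tsum_eq_zero_add).trans_le ?_
      simp [consZero]

@[simp] theorem shiftRight_zero (q : ℓ¹(ℕ, ℝ)) : shiftRight q 0 = 0 := rfl

@[simp] theorem shiftRight_succ (q : ℓ¹(ℕ, ℝ)) (n : ℕ) : shiftRight q (n + 1) = q n := rfl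

/-- The left shift on `ℓ¹`. -/
noncomputable def shiftLeft : ℓ¹(ℕ, ℝ) →L[ℝ] ℓ¹(ℕ, ℝ) :=
  LinearMap.mkContinuous
    { toFun := fun q => lpOfSummable (fun n => q (n + 1))
        ((summable_nat_add_iff 1).2 (summable_lp_one q))
      map_add' := fun q q' => by
        ext n
        rfl
      map_smul' := fun c q => by
        ext n
        rfl }
    1 fun q => by
      rw [one_mul, norm_lp_one, norm_lp_one, (summable_lp_one q).tsum_eq_zero_add]
      exact le_add_of_nonneg_left (abs_nonneg _)

/-- Generator of the arrivals at unit rate. -/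
noncomputable def arrivalGen : ℓ¹(ℕ, ℝ) →L[ℝ] ℓ¹(ℕ, ℝ) :=
  shiftRight - ContinuousLinearMap.id ℝ _

/-- Generator of the services at unit rate. -/
noncomputable def serviceGen : ℓ¹(ℕ, ℝ) →L[ℝ] ℓ¹(ℕ, ℝ) :=
  shiftLeft - ContinuousLinearMap.id ℝ _ +
    (lp.singleContinuousLinearMap ℝ (fun _ : ℕ => ℝ) 1 0).comp
      (lp.evalCLM ℝ (fun _ : ℕ => ℝ) 1 0)

theorem evalCLM_apply (q : ℓ¹(ℕ, ℝ)) (n : ℕ) :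
    lp.evalCLM ℝ (fun _ : ℕ => ℝ) 1 n q = q n := rfl

theorem arrivalGen_apply (q : ℓ¹(ℕ, ℝ)) (n : ℕ) : arrivalGen q n = shiftRight q n - q n := rfl

theorem arrivalGen_zero (q : ℓ¹(ℕ, ℝ)) : arrivalGen q 0 = -q 0 := by
  rw [arrivalGen_apply, shiftRight_zero, zero_sub]

theorem arrivalGen_succ (q : ℓ¹(ℕ, ℝ)) (n : ℕ) : arrivalGen q (n + 1) = q n - q (n + 1) := rfl

theorem serviceGen_apply (q : ℓ¹(ℕ, ℝ)) (n : ℕ) : serviceGen q n =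
    q (n + 1) - q n + (lp.single 1 0 (q 0) : ℓ¹(ℕ, ℝ)) n := rfl

theorem serviceGen_zero (q : ℓ¹(ℕ, ℝ)) : serviceGen q 0 = q 1 := by
  simp [serviceGen_apply]

theorem serviceGen_succ (q : ℓ¹(ℕ, ℝ)) (n : ℕ) :
    serviceGen q (n + 1) = q (n + 2) - q (n + 1) := by
  simp [serviceGen_apply]

theorem hasSum_lp_one (q : ℓ¹(ℕ, ℝ)) : HasSum (fun n => q n) (lp.tsumCLM ℝ ℕ ℝ q) :=
  (summable_lp_one q).of_abs.hasSum

theorem tsumCLM_arrivalGen (q : ℓ¹(ℕ, ℝ)) : lp.tsumCLM ℝ ℕ ℝ (arrivalGen q) = 0 := by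
  have h : HasSum (fun n => shiftRight q n) (lp.tsumCLM ℝ ℕ ℝ q) := by
    rw [← hasSum_nat_add_iff' 1]
    simpa using hasSum_lp_one q
  rw [arrivalGen, sub_apply, map_sub, ContinuousLinearMap.id_apply,
    (hasSum_lp_one _).unique h, sub_self]

theorem tsumCLM_serviceGen (q : ℓ¹(ℕ, ℝ)) : lp.tsumCLM ℝ ℕ ℝ (serviceGen q) = 0 := by
  refine (hasSum_lp_one _).unique ?_
  rw [← hasSum_nat_add_iff' 1]
  simp only [serviceGen_succ, Finset.sum_range_one, serviceGen_zero, zero_sub]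
  have h1 := (hasSum_nat_add_iff' 1).2 (hasSum_lp_one q)
  have h2 := (hasSum_nat_add_iff' 2).2 (hasSum_lp_one q)
  convert h2.sub h1 using 1
  simp [Finset.sum_range_succ]

/-- States `(δ, q)` with `0 ≤ δ ≤ lam` and `q` a probability law. -/
def stateSet (lam : ℝ) : Set (ℝ × ℓ¹(ℕ, ℝ)) :=
  {x | (0 ≤ x.1 ∧ x.1 ≤ lam) ∧ (∀ n, 0 ≤ x.2 n) ∧ lp.tsumCLM ℝ ℕ ℝ x.2 = 1}

/-- One step, of length `1 / c`, of the Euler scheme for the nonlinear system. -/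
noncomputable def eulerStep (lam mu c : ℝ) (x : ℝ × ℓ¹(ℕ, ℝ)) : ℝ × ℓ¹(ℕ, ℝ) :=
  (x.1 + c⁻¹ * (lam * mu * (1 - x.2 0) - mu * x.1),
    x.2 + c⁻¹ • (x.1 • arrivalGen x.2 + lam • serviceGen x.2))

theorem convex_stateSet (lam : ℝ) : Convex ℝ (stateSet lam) := by
  rintro x ⟨⟨hx1, hx2⟩, hx3, hx4⟩ y ⟨⟨hy1, hy2⟩, hy3, hy4⟩ a b ha hb hab
  refine ⟨⟨?_, ?_⟩, fun n => ?_, ?_⟩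
  · exact add_nonneg (mul_nonneg ha hx1) (mul_nonneg hb hy1)
  · calc a * x.1 + b * y.1 ≤ a * lam + b * lam := by gcongr
      _ = lam := by rw [← add_mul, hab, one_mul]
  · exact add_nonneg (mul_nonneg ha (hx3 n)) (mul_nonneg hb (hy3 n))
  · simp only [Prod.snd_add, Prod.smul_snd, map_add, map_smul, hx4, hy4, smul_eq_mul, mul_one, hab]

theorem isClosed_stateSet (lam : ℝ) : IsClosed (stateSet lam) := by
  have h1 : Continuous fun x : ℝ × ℓ¹(ℕ, ℝ) => x.1 := continuous_fst
  have h2 : ∀ n, Continuous fun x : ℝ × ℓ¹(ℕ, ℝ) => x.2 n := fun n =>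
    (lp.evalCLM ℝ (fun _ : ℕ => ℝ) 1 n).continuous.comp continuous_snd
  have h3 : Continuous fun x : ℝ × ℓ¹(ℕ, ℝ) => lp.tsumCLM ℝ ℕ ℝ x.2 :=
    (lp.tsumCLM ℝ ℕ ℝ).continuous.comp continuous_snd
  refine ((isClosed_le continuous_const h1).inter (isClosed_le h1 continuous_const)).inter
    (IsClosed.inter ?_ (isClosed_eq h3 continuous_const))
  change IsClosed {x : ℝ × ℓ¹(ℕ, ℝ) | ∀ n, 0 ≤ x.2 n}
  rw [ofPred_forall]
  exact isClosed_iInter fun n => isClosed_le continuous_const (h2 n)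

theorem norm_le_of_mem_stateSet {lam : ℝ} {x : ℝ × ℓ¹(ℕ, ℝ)} (hx : x ∈ stateSet lam) :
    |x.1| ≤ lam ∧ ‖x.2‖ ≤ 1 := by
  refine ⟨by rw [abs_of_nonneg hx.1.1]; exact hx.1.2, ?_⟩
  rw [norm_lp_one, ← hx.2.2]
  simp only [abs_of_nonneg (hx.2.1 _)]
  exact (hasSum_lp_one x.2).tsum_eq.le

theorem isBounded_stateSet (lam : ℝ) : Bornology.IsBounded (stateSet lam) :=
  isBounded_iff_forall_norm_le.2 ⟨max lam 1, fun _ hx => max_le_max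
    (norm_le_of_mem_stateSet hx).1 (norm_le_of_mem_stateSet hx).2⟩

/-- For `c ≥ mu` the new rate is a convex combination of the old one and `lam * (1 - q 0)`. For `c ≥
2 * lam` the diagonal coefficients `c - δ - lam` are nonnegative, because `δ ≤ lam` on the state
set. -/
theorem mapsTo_eulerStep {lam mu c : ℝ} (hlam : 0 ≤ lam) (hmu : 0 ≤ mu) (hc : 0 < c)
    (hcmu : mu ≤ c) (hclam : 2 * lam ≤ c) :
    MapsTo (eulerStep lam mu c) (stateSet lam) (stateSet lam) := by
  rintro x ⟨⟨hx1, hx2⟩, hx3, hx4⟩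
  have hq0 : x.2 0 ≤ 1 := by
    rw [← hx4]
    exact le_hasSum (hasSum_lp_one x.2) 0 fun n _ => hx3 n
  have hrate : (eulerStep lam mu c x).1 =
      c⁻¹ * ((c - mu) * x.1 + mu * (lam * (1 - x.2 0))) := by
    simp only [eulerStep]
    field_simp
    ring
  have h1 : 0 ≤ lam * (1 - x.2 0) := mul_nonneg hlam (sub_nonneg.2 hq0)
  have h2 : lam * (1 - x.2 0) ≤ lam := by
    have := mul_nonneg hlam (hx3 0)
    linarith
  refine ⟨⟨?_, ?_⟩, fun n => ?_, ?_⟩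
  · rw [hrate]
    have := mul_nonneg (sub_nonneg.2 hcmu) hx1
    have := mul_nonneg hmu h1
    positivity
  · rw [hrate, inv_mul_le_iff₀ hc]
    have := mul_le_mul_of_nonneg_left hx2 (sub_nonneg.2 hcmu)
    have := mul_le_mul_of_nonneg_left h2 hmu
    linarith
  · have key : 0 ≤ c * x.2 n + (x.1 * arrivalGen x.2 n + lam * serviceGen x.2 n) := by
      cases n with
      | zero =>
        rw [arrivalGen_zero, serviceGen_zero]
        have := mul_nonneg hlam (hx3 1)
        have := mul_le_mul_of_nonneg_right (show x.1 ≤ c by linarith) (hx3 0)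
        linarith
      | succ n =>
        rw [arrivalGen_succ, serviceGen_succ]
        have := mul_nonneg hlam (hx3 (n + 2))
        have := mul_nonneg hx1 (hx3 n)
        have := mul_le_mul_of_nonneg_right (show x.1 + lam ≤ c by linarith) (hx3 (n + 1))
        linarith
    have heq : (eulerStep lam mu c x).2 n =
        c⁻¹ * (c * x.2 n + (x.1 * arrivalGen x.2 n + lam * serviceGen x.2 n)) := by
      simp only [eulerStep, lp_add_apply, lp_smul_apply]
      rw [mul_add c⁻¹ (c * _), inv_mul_cancel_left₀ hc.ne']
    rw [heq]
    exact mul_nonneg (inv_nonneg.2 hc.le) key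
  · simp only [eulerStep, map_add, map_smul, tsumCLM_arrivalGen, tsumCLM_serviceGen, hx4, smul_zero,
      add_zero]

/-- The only nonlinear term, `δ • arrivalGen q`, is bilinear, hence Lipschitz on a bounded set; `l`
collects the linear terms. -/
theorem exists_lipschitzOnWith_eulerStep (lam mu c : ℝ) :
    ∃ L : ℝ≥0, LipschitzOnWith L (eulerStep lam mu c) (stateSet lam) := by
  let l : ℝ × ℓ¹(ℕ, ℝ) →L[ℝ] ℝ × ℓ¹(ℕ, ℝ) :=
    ((ContinuousLinearMap.fst ℝ ℝ ℓ¹(ℕ, ℝ)) - c⁻¹ • ((lam * mu) •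
      (lp.evalCLM ℝ (fun _ : ℕ => ℝ) 1 0).comp (ContinuousLinearMap.snd ℝ ℝ ℓ¹(ℕ, ℝ)) +
      mu • ContinuousLinearMap.fst ℝ ℝ ℓ¹(ℕ, ℝ))).prod
    ((ContinuousLinearMap.snd ℝ ℝ ℓ¹(ℕ, ℝ)) + (c⁻¹ * lam) • serviceGen.comp
      (ContinuousLinearMap.snd ℝ ℝ ℓ¹(ℕ, ℝ)))
  have hdiff : ∀ x y, eulerStep lam mu c x - eulerStep lam mu c y = l (x - y) +
      (0, c⁻¹ • (x.1 • arrivalGen (x.2 - y.2) + (x.1 - y.1) • arrivalGen y.2)) := by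
    intro x y
    refine Prod.ext ?_ ?_
    · simp [l, eulerStep, evalCLM_apply]
      ring
    · simp [l, eulerStep]
      module
  refine ⟨(‖l‖ + |c⁻¹| * (|lam| * ‖arrivalGen‖ + ‖arrivalGen‖)).toNNReal,
    LipschitzOnWith.of_dist_le_mul fun x hx y hy => ?_⟩
  rw [Real.coe_toNNReal _ (by positivity), dist_eq_norm, dist_eq_norm, hdiff, add_mul]
  refine (norm_add_le _ _).trans (add_le_add (l.le_opNorm _) ?_)
  rw [Prod.norm_mk, norm_zero, max_eq_right (norm_nonneg _), norm_smul, mul_assoc]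
  refine mul_le_mul_of_nonneg_left ((norm_add_le _ _).trans ?_) (abs_nonneg _)
  rw [add_mul, norm_smul, norm_smul]
  have hxn := (norm_le_of_mem_stateSet hx).1.trans (le_abs_self lam)
  have hyn := (norm_le_of_mem_stateSet hy).2
  have h1 : ‖x.2 - y.2‖ ≤ ‖x - y‖ := norm_snd_le (x - y)
  have h2 : ‖x.1 - y.1‖ ≤ ‖x - y‖ := norm_fst_le (x - y)
  refine add_le_add ?_ ?_
  · rw [mul_assoc]
    exact mul_le_mul hxn ((arrivalGen.le_opNorm _).trans (by gcongr)) (norm_nonneg _)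
      (abs_nonneg _)
  · rw [mul_comm]
    refine mul_le_mul ((arrivalGen.le_opNorm _).trans ?_) h2 (norm_nonneg _) (norm_nonneg _)
    exact mul_le_of_le_one_right (norm_nonneg _) hyn

/-- Global existence for the nonlinear Kolmogorov system. -/
theorem exists_isQueueLaw_of_feedback {lam mu : ℝ} (hlam : 0 < lam) (hmu : 0 < mu) {p : ℕ → ℝ}
    (hp : ∀ k, 0 ≤ p k) (hp1 : HasSum p 1) :
    ∃ (δ : ℝ → ℝ) (q : ℕ → ℝ → ℝ), IsQueueLaw lam p δ q ∧ δ 0 = 0 ∧ (∀ t, 0 ≤ t → 0 ≤ δ t) ∧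
      ∀ t, 0 ≤ t → HasDerivWithinAt δ (lam * mu * (1 - q 0 t) - mu * δ t) (Ici 0) t := by
  -- The system is `x' = c (eulerStep x - x)`, so the solution of `x' = eulerStep x - x` is read at
  -- time `c * t`.
  set c := mu + 2 * lam with hc
  have hc0 : 0 < c := by positivity
  obtain ⟨L, hL⟩ := exists_lipschitzOnWith_eulerStep lam mu c
  let p' : ℓ¹(ℕ, ℝ) := lpOfSummable p hp1.summable.abs
  have hp' : ((0 : ℝ), p') ∈ stateSet lam :=
    ⟨⟨le_rfl, hlam.le⟩, hp, (hasSum_lp_one p').unique hp1⟩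
  obtain ⟨x, hx0, hx⟩ := exists_global_solution (convex_stateSet lam) (isClosed_stateSet lam)
    (isBounded_stateSet lam) hL
    (mapsTo_eulerStep hlam.le hmu.le hc0 (by linarith) (by linarith)) hp'
  have hmem : ∀ t, 0 ≤ t → x (c * t) ∈ stateSet lam := fun t ht =>
    (hx _ (mul_nonneg hc0.le ht)).1
  have hder : ∀ t, 0 ≤ t → HasDerivWithinAt (fun t => x (c * t))
      (lam * mu * (1 - (x (c * t)).2 0) - mu * (x (c * t)).1,
        (x (c * t)).1 • arrivalGen (x (c * t)).2 + lam • serviceGen (x (c * t)).2) (Ici 0) t := by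
    intro t ht
    have h1 : HasDerivWithinAt (fun t => c * t) c (Ici 0) t := by
      simpa using ((hasDerivAt_id t).const_mul c).hasDerivWithinAt
    refine (HasDerivWithinAt.scomp t (hx _ (mul_nonneg hc0.le ht)).2 h1
      fun s hs => mul_nonneg hc0.le hs).congr_deriv ?_
    simp only [eulerStep]
    refine Prod.ext ?_ ?_
    · simp only [Prod.smul_fst, Prod.fst_sub, add_sub_cancel_left, smul_eq_mul]
      rw [mul_inv_cancel_left₀ hc0.ne']
    · simp only [Prod.smul_snd, Prod.snd_sub, add_sub_cancel_left]
      rw [smul_inv_smul₀ hc0.ne']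
  have hderq : ∀ n t, 0 ≤ t → HasDerivWithinAt (fun t => (x (c * t)).2 n)
      ((x (c * t)).1 * arrivalGen (x (c * t)).2 n + lam * serviceGen (x (c * t)).2 n)
      (Ici 0) t := fun n t ht =>
    ((lp.evalCLM ℝ (fun _ : ℕ => ℝ) 1 n).comp
      (ContinuousLinearMap.snd ℝ ℝ ℓ¹(ℕ, ℝ))).hasFDerivAt.comp_hasDerivWithinAt t (hder t ht)
  refine ⟨fun t => (x (c * t)).1, fun n t => (x (c * t)).2 n, ⟨fun n => ?_, fun n t ht =>
    (hmem t ht).2.1 n, fun t ht => ?_, fun t ht => ?_, fun n t ht => ?_⟩, ?_, fun t ht =>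
    (hmem t ht).1.1, fun t ht => ?_⟩
  · rw [mul_zero, hx0]
    rfl
  · rw [← (hmem t ht).2.2]
    exact hasSum_lp_one _
  · refine (hderq 0 t ht).congr_deriv ?_
    rw [arrivalGen_zero, serviceGen_zero]
    ring
  · refine (hderq (n + 1) t ht).congr_deriv ?_
    rw [arrivalGen_succ, serviceGen_succ]
    ring
  · simp only [mul_zero, hx0]
  · exact (ContinuousLinearMap.fst ℝ ℝ ℓ¹(ℕ, ℝ)).hasFDerivAt.comp_hasDerivWithinAt t (hder t ht)

/-! ### The integrating factor and the contour integrals -/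

theorem phi_congr (lam : ℝ) {δ δ' : ℝ → ℝ} (z : ℂ) {t : ℝ} (ht : 0 ≤ t)
    (h : ∀ s, 0 ≤ s → δ s = δ' s) : phi lam δ z t = phi lam δ' z t := by
  unfold phi
  congr 2
  refine intervalIntegral.integral_congr fun s hs => ?_
  rw [uIcc_of_le ht] at hs
  simp only [h s hs.1]

theorem psi_congr (lam : ℝ) (p : ℕ → ℝ) (r : ℝ) {δ δ' : ℝ → ℝ} {t : ℝ} (ht : 0 ≤ t)
    (h : ∀ s, 0 ≤ s → δ s = δ' s) : psi lam p r δ t = psi lam p r δ' t := by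
  simp only [psi, phi_congr lam _ ht h]

theorem kernelD_congr (lam r : ℝ) {δ δ' : ℝ → ℝ} {s t : ℝ} (hs : 0 ≤ s) (ht : 0 ≤ t)
    (h : ∀ s, 0 ≤ s → δ s = δ' s) : kernelD lam r δ s t = kernelD lam r δ' s t := by
  simp only [kernelD, phi_congr lam _ ht h, phi_congr lam _ hs h]

/-- The exponent of `φ`. -/
noncomputable def phiExponent (lam : ℝ) (δ : ℝ → ℝ) (z : ℂ) (t : ℝ) : ℂ :=
  (1 - 1 / z) * ((lam : ℂ) * t - z * ((∫ s in (0 : ℝ)..t, δ s : ℝ) : ℂ))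

theorem phi_eq_exp (lam : ℝ) {δ : ℝ → ℝ} (hδ : Continuous δ) (z : ℂ) (t : ℝ) :
    phi lam δ z t = Complex.exp (phiExponent lam δ z t) := by
  rw [phi, phiExponent, intervalIntegral.integral_sub, intervalIntegral.integral_const,
    intervalIntegral.integral_const_mul, intervalIntegral.integral_ofReal]
  · simp [mul_comm]
  · exact continuous_const.intervalIntegrable _ _
  · exact (by fun_prop : Continuous fun s => z * (δ s : ℂ)).intervalIntegrable _ _

theorem phi_ne_zero (lam : ℝ) (δ : ℝ → ℝ) (z : ℂ) (t : ℝ) : phi lam δ z t ≠ 0 :=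
  Complex.exp_ne_zero _

theorem hasDerivAt_phi (lam : ℝ) {δ : ℝ → ℝ} (hδ : Continuous δ) (z : ℂ) (t : ℝ) :
    HasDerivAt (phi lam δ z) (phi lam δ z t * ((1 - 1 / z) * (lam - z * δ t))) t := by
  have hc : Continuous fun s : ℝ => (lam : ℂ) - z * (δ s : ℂ) := by fun_prop
  exact ((hc.integral_hasStrictDerivAt 0 t).hasDerivAt.const_mul (1 - 1 / z)).cexp

theorem continuous_circleMap_inv_zero {r : ℝ} (hr : 0 < r) :
    Continuous fun θ => (circleMap 0 r θ)⁻¹ :=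
  (continuous_circleMap 0 r).inv₀ fun _ => circleMap_ne_center hr.ne'

theorem continuous_phi_circleMap (lam : ℝ) {δ : ℝ → ℝ} (hδ : Continuous δ) {r : ℝ} (hr : 0 < r) :
    Continuous fun x : ℝ × ℝ => phi lam δ (circleMap 0 r x.1) x.2 := by
  have h1 := (continuous_circleMap_inv_zero hr).comp (continuous_fst (X := ℝ) (Y := ℝ))
  have h2 := (continuous_circleMap 0 r).comp (continuous_fst (X := ℝ) (Y := ℝ))
  have h3 : Continuous fun x : ℝ × ℝ => ∫ s in (0 : ℝ)..x.2, δ s :=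
    (intervalIntegral.continuous_primitive (fun _ _ => hδ.intervalIntegrable _ _) 0).comp
      continuous_snd
  simp only [Function.comp_def] at h1 h2
  simp only [phi_eq_exp lam hδ, phiExponent, one_div]
  fun_prop

/-- The integrand of `D` on the circle, jointly continuous in the angle and in `s`. -/
theorem continuous_kernelD_integrand (lam : ℝ) {δ : ℝ → ℝ} (hδ : Continuous δ) {r : ℝ}
    (hr : 0 < r) (t : ℝ) :
    Continuous fun x : ℝ × ℝ => phi lam δ (circleMap 0 r x.1) x.2 /
      phi lam δ (circleMap 0 r x.1) t *
        ((1 - 1 / circleMap 0 r x.1) / circleMap 0 r x.1) := by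
  have h1 := (continuous_circleMap_inv_zero hr).comp (continuous_fst (X := ℝ) (Y := ℝ))
  have h2 := continuous_phi_circleMap lam hδ hr
  have h3 : Continuous fun x : ℝ × ℝ => phi lam δ (circleMap 0 r x.1) t :=
    h2.comp (continuous_fst.prodMk continuous_const)
  simp only [Function.comp_def] at h1
  simp only [div_eq_mul_inv _ (circleMap _ _ _), one_mul]
  exact (h2.div h3 fun _ => phi_ne_zero _ _ _ _).mul ((continuous_const.sub h1).mul h1)

theorem continuous_kernelD (lam : ℝ) {δ : ℝ → ℝ} (hδ : Continuous δ) {r : ℝ} (hr : 0 < r)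
    (t : ℝ) : Continuous fun s => kernelD lam r δ s t := by
  unfold kernelD circleIntegral
  refine continuous_const.mul
    (intervalIntegral.continuous_parametric_intervalIntegral_of_continuous' ?_ _ _)
  have h1 := (continuous_kernelD_integrand lam hδ hr t).comp continuous_swap
  simp only [deriv_circleMap]
  have h2 : Continuous fun x : ℝ × ℝ => circleMap 0 r x.2 * Complex.I :=
    ((continuous_circleMap 0 r).comp continuous_snd).mul continuous_const
  exact h2.smul h1

theorem circleIntegral_intervalIntegral_swap {r a b : ℝ} {f : ℂ → ℝ → ℂ}
    (hf : Continuous fun x : ℝ × ℝ => f (circleMap 0 r x.1) x.2) :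
    (∮ z in C((0 : ℂ), r), ∫ s in a..b, f z s) = ∫ s in a..b, ∮ z in C((0 : ℂ), r), f z s := by
  unfold circleIntegral
  simp only [deriv_circleMap, ← intervalIntegral.integral_smul]
  refine intervalIntegral_intervalIntegral_swap ?_
  have h2 : Continuous fun x : ℝ × ℝ => circleMap 0 r x.1 * Complex.I :=
    ((continuous_circleMap 0 r).comp continuous_fst).mul continuous_const
  have h3 : IntegrableOn (fun x : ℝ × ℝ => (circleMap 0 r x.1 * Complex.I) •
      f (circleMap 0 r x.1) x.2) (uIcc 0 (2 * Real.pi) ×ˢ uIcc a b) :=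
    (h2.smul hf).continuousOn.integrableOn_compact (isCompact_uIcc.prod isCompact_uIcc)
  exact h3.mono_set (prod_mono uIoc_subset_uIcc uIoc_subset_uIcc)

section InitialGen

variable {p : ℕ → ℝ}

theorem norm_initialGen_term_le (hp : ∀ k, 0 ≤ p k) {z : ℂ} (hz : ‖z‖ ≤ 1) (k : ℕ) :
    ‖(p k : ℂ) * z ^ k‖ ≤ p k := by
  rw [norm_mul, norm_pow, Complex.norm_real, Real.norm_of_nonneg (hp k)]
  exact mul_le_of_le_one_right (hp k) (pow_le_one₀ (norm_nonneg _) hz)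

theorem hasSum_initialGen (hp : ∀ k, 0 ≤ p k) (hp1 : HasSum p 1) {z : ℂ} (hz : ‖z‖ ≤ 1) :
    HasSum (fun k => (p k : ℂ) * z ^ k) (initialGen p z) :=
  (Summable.of_norm_bounded hp1.summable (norm_initialGen_term_le hp hz)).hasSum

theorem norm_initialGen_le (hp : ∀ k, 0 ≤ p k) (hp1 : HasSum p 1) {z : ℂ} (hz : ‖z‖ ≤ 1) :
    ‖initialGen p z‖ ≤ 1 :=
  tsum_of_norm_bounded hp1 (norm_initialGen_term_le hp hz)

theorem continuousOn_initialGen (hp : ∀ k, 0 ≤ p k) (hp1 : HasSum p 1) :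
    ContinuousOn (initialGen p) (Metric.closedBall 0 1) :=
  continuousOn_tsum (fun k => by fun_prop) hp1.summable fun k z hz =>
    norm_initialGen_term_le hp (mem_closedBall_zero_iff.1 hz) k

theorem differentiableOn_initialGen (hp : ∀ k, 0 ≤ p k) (hp1 : HasSum p 1) :
    DifferentiableOn ℂ (initialGen p) (Metric.ball 0 1) :=
  Complex.differentiableOn_tsum_of_summable_norm hp1.summable (fun k => by fun_prop) Metric.isOpen_ball
    fun k z hz => norm_initialGen_term_le hp (mem_ball_zero_iff.1 hz).le k

theorem initialGen_zero (p : ℕ → ℝ) : initialGen p 0 = p 0 := by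
  rw [initialGen, tsum_eq_single 0]
  · simp
  · intro k hk
    simp [hk]

/-- Cauchy's formula for the probability of an empty queue. -/
theorem circleIntegral_initialGen_div (hp : ∀ k, 0 ≤ p k) (hp1 : HasSum p 1) {r : ℝ} (hr : 0 < r)
    (hr1 : r ≤ 1) :
    (2 * (Real.pi : ℂ) * Complex.I)⁻¹ * (∮ z in C((0 : ℂ), r), initialGen p z / z) = p 0 := by
  -- When `r = 1` the series is known to be holomorphic only inside the disc; continuity up to the
  -- boundary suffices.
  have h := Complex.circleIntegral_sub_center_inv_smul_of_differentiable_on_off_countable hr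
    countable_empty ((continuousOn_initialGen hp hp1).mono (Metric.closedBall_subset_closedBall hr1))
    fun z hz => (differentiableOn_initialGen hp hp1).differentiableAt
      (Metric.isOpen_ball.mem_nhds (Metric.ball_subset_ball hr1 hz.1))
  simp only [sub_zero, smul_eq_mul, initialGen_zero] at h
  simp only [div_eq_inv_mul, h]
  rw [inv_mul_cancel_left₀ Complex.two_pi_I_ne_zero]

end InitialGen

/-! ### From the Kolmogorov equations to the Volterra equation -/

theorem hasSum_of_eq {f g : ℕ → ℂ} {a b : ℂ} (h : HasSum f a) (hfg : ∀ n, g n = f n)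
    (hab : b = a) : HasSum g b := by
  rw [hab, funext hfg]
  exact h

/-- Freezing at negative times turns continuity on `[0, ∞)` into continuity on `ℝ`, without changing
anything the equations see. -/
theorem IsQueueLaw.extend {lam : ℝ} {p : ℕ → ℝ} {δ : ℝ → ℝ} {q : ℕ → ℝ → ℝ}
    (hq : IsQueueLaw lam p δ q) :
    IsQueueLaw lam p (fun t => δ (max t 0)) fun n t => q n (max t 0) where
  initial n := by simpa using hq.initial n
  nonneg n t ht := by simpa [max_eq_left ht] using hq.nonneg n t ht
  hasSum_one t ht := by simpa [max_eq_left ht] using hq.hasSum_one t ht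
  deriv_zero t ht := by
    simp only [max_eq_left ht]
    exact (hq.deriv_zero t ht).congr (fun s hs => by simp [max_eq_left (show 0 ≤ s from hs)])
      (by simp [max_eq_left ht])
  deriv_succ n t ht := by
    simp only [max_eq_left ht]
    exact (hq.deriv_succ n t ht).congr (fun s hs => by simp [max_eq_left (show 0 ≤ s from hs)])
      (by simp [max_eq_left ht])

theorem continuous_comp_max_zero {f : ℝ → ℝ} (hf : ContinuousOn f (Ici 0)) :
    Continuous fun t => f (max t 0) :=
  hf.comp_continuous (by fun_prop) fun t => le_max_right t 0

theorem IsQueueLaw.continuousOn {lam : ℝ} {p : ℕ → ℝ} {δ : ℝ → ℝ} {q : ℕ → ℝ → ℝ}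
    (hq : IsQueueLaw lam p δ q) (n : ℕ) : ContinuousOn (q n) (Ici 0) := by
  cases n with
  | zero => exact fun t ht => (hq.deriv_zero t ht).continuousWithinAt
  | succ n => exact fun t ht => (hq.deriv_succ n t ht).continuousWithinAt

/-- The right-hand side of the forward Kolmogorov equations. -/
noncomputable def kolmogorov (lam : ℝ) (δ : ℝ → ℝ) (q : ℕ → ℝ → ℝ) (n : ℕ) (t : ℝ) : ℝ :=
  δ t * (consZero (fun k => q k t) n - q n t) +
    lam * (q (n + 1) t - q n t + if n = 0 then q 0 t else 0)

theorem IsQueueLaw.hasDerivWithinAt {lam : ℝ} {p : ℕ → ℝ} {δ : ℝ → ℝ} {q : ℕ → ℝ → ℝ}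
    (hq : IsQueueLaw lam p δ q) (n : ℕ) {t : ℝ} (ht : 0 ≤ t) :
    HasDerivWithinAt (q n) (kolmogorov lam δ q n t) (Ici 0) t := by
  cases n with
  | zero =>
    refine (hq.deriv_zero t ht).congr_deriv ?_
    simp [kolmogorov, consZero]
  | succ n =>
    refine (hq.deriv_succ n t ht).congr_deriv ?_
    simp [kolmogorov, consZero]
    ring

section

variable {lam : ℝ} {p : ℕ → ℝ} {δ : ℝ → ℝ} {q : ℕ → ℝ → ℝ}

/-- Arrivals contribute `δ (z - 1)` and services `lam (1/z - 1)`, both multiples of `1 - 1/z`; the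
absence of service in the empty state adds `lam (1 - 1/z) q 0`. -/
theorem hasSum_kolmogorov_mul_pow (hq : IsQueueLaw lam p δ q) {z : ℂ} (hz : ‖z‖ ≤ 1)
    (hz0 : z ≠ 0) {t : ℝ} (ht : 0 ≤ t) :
    HasSum (fun n => (kolmogorov lam δ q n t : ℂ) * z ^ n)
      ((1 - 1 / z) * ((z * δ t - lam) * initialGen (fun n => q n t) z + lam * q 0 t)) := by
  have hG := hasSum_initialGen (fun k => hq.nonneg k t ht) (hq.hasSum_one t ht) hz
  set G := initialGen (fun n => q n t) z
  have hcons : HasSum (fun n => (consZero (fun k => q k t) n : ℂ) * z ^ n) (z * G) := by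
    rw [← hasSum_nat_add_iff' 1]
    simp only [consZero, Finset.sum_range_one, Complex.ofReal_zero, zero_mul, sub_zero]
    exact hasSum_of_eq (hG.mul_left z) (fun n => by ring) rfl
  have hshift : HasSum (fun n => (q (n + 1) t : ℂ) * z ^ n) (z⁻¹ * (G - q 0 t)) := by
    have h := ((hasSum_nat_add_iff' 1).2 hG).mul_left z⁻¹
    simp only [Finset.sum_range_one, pow_zero, mul_one] at h
    refine hasSum_of_eq h (fun n => ?_) rfl
    field_simp
    ring
  have hsing : HasSum (fun n => ((if n = 0 then q 0 t else 0 : ℝ) : ℂ) * z ^ n) (q 0 t) := by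
    convert hasSum_ite_eq 0 (q 0 t : ℂ) using 2 with n
    split_ifs with h <;> simp [h]
  have h := ((hcons.sub hG).mul_left (δ t : ℂ)).add
    (((hshift.sub hG).add hsing).mul_left (lam : ℂ))
  refine hasSum_of_eq h (fun n => ?_) ?_
  · simp only [kolmogorov]
    push_cast
    ring
  · field_simp
    ring

theorem continuous_kolmogorov (hδ : Continuous δ) (hqc : ∀ n, Continuous (q n)) (n : ℕ) :
    Continuous (kolmogorov lam δ q n) := by
  have h1 := hqc 0
  have h2 := hqc n
  have h3 := hqc (n + 1)
  have h4 : Continuous fun t => consZero (fun k => q k t) n := by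
    cases n with
    | zero => exact continuous_const
    | succ n => exact hqc n
  unfold kolmogorov
  split_ifs <;> fun_prop

theorem abs_kolmogorov_le (hq : IsQueueLaw lam p δ q) (n : ℕ) {t : ℝ} (ht : 0 ≤ t) :
    |kolmogorov lam δ q n t| ≤
      (|δ t| + 2 * |lam|) * (consZero (fun k => q k t) n + q n t + q (n + 1) t) := by
  have h1 := hq.nonneg n t ht
  have h2 := hq.nonneg (n + 1) t ht
  have h3 : 0 ≤ consZero (fun k => q k t) n := by
    cases n with
    | zero => exact le_rfl
    | succ n => exact hq.nonneg n t ht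
  have h4 : |consZero (fun k => q k t) n - q n t| ≤
      consZero (fun k => q k t) n + q n t + q (n + 1) t := by
    rw [abs_le]
    constructor <;> linarith
  have h5 : |q (n + 1) t - q n t + if n = 0 then q 0 t else 0| ≤
      2 * (consZero (fun k => q k t) n + q n t + q (n + 1) t) := by
    rw [abs_le]
    split_ifs with h
    · subst h
      constructor <;> linarith
    · constructor <;> linarith
  refine (abs_add_le _ _).trans ?_
  rw [abs_mul, abs_mul, add_mul, mul_comm 2, mul_assoc]
  gcongr

theorem hasSum_consZero_add (hq : IsQueueLaw lam p δ q) {t : ℝ} (ht : 0 ≤ t) :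
    HasSum (fun n => consZero (fun k => q k t) n + q n t + q (n + 1) t) (3 - q 0 t) := by
  have h := hq.hasSum_one t ht
  have hcons : HasSum (consZero fun k => q k t) 1 := by
    rw [← hasSum_nat_add_iff' 1]
    simpa [consZero] using h
  have hshift := (hasSum_nat_add_iff' 1).2 h
  convert (hcons.add h).add hshift using 1
  simp
  ring

/-- The generating function of the law solves the linear equation with integrating factor `φ`. -/
theorem phi_mul_initialGen (hq : IsQueueLaw lam p δ q) (hδ : Continuous δ)
    (hqc : ∀ n, Continuous (q n)) {z : ℂ} (hz : ‖z‖ ≤ 1) (hz0 : z ≠ 0) {t : ℝ} (ht : 0 ≤ t) :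
    phi lam δ z t * initialGen (fun n => q n t) z = initialGen p z +
      ∫ s in (0 : ℝ)..t, phi lam δ z s * ((1 - 1 / z) * (lam * q 0 s)) := by
  have hphi : Continuous (phi lam δ z) :=
    continuous_iff_continuousAt.2 fun s => (hasDerivAt_phi lam hδ z s).continuousAt
  -- `W n` is the time derivative of `φ q n zⁿ`. Integrating each term before summing replaces
  -- differentiation of the series in `t` by dominated convergence.
  let W : ℕ → ℝ → ℂ := fun n s => phi lam δ z s *
    (kolmogorov lam δ q n s * z ^ n + (1 - 1 / z) * (lam - z * δ s) * (q n s * z ^ n))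
  have hW : ∀ n, Continuous (W n) := fun n => by
    have h1 := continuous_kolmogorov (lam := lam) hδ hqc n
    have h2 := hqc n
    fun_prop
  have hphi0 : phi lam δ z 0 = 1 := by simp [phi]
  have hint : ∀ n, ∫ s in (0 : ℝ)..t, W n s = phi lam δ z t * (q n t * z ^ n) - p n * z ^ n := by
    intro n
    have h2 := hqc n
    have hF : Continuous fun s => phi lam δ z s * (q n s * z ^ n) := by fun_prop
    rw [intervalIntegral.integral_eq_sub_of_hasDeriv_right_of_le
      (f := fun s => phi lam δ z s * (q n s * z ^ n)) ht hF.continuousOn (fun s hs => ?_)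
      ((hW n).intervalIntegrable 0 t), hphi0, one_mul, hq.initial]
    have h3 := ((hq.hasDerivWithinAt n hs.1.le).mono
      (Ioi_subset_Ici hs.1.le)).ofReal_comp.mul_const (z ^ n)
    refine ((hasDerivAt_phi lam hδ z s).hasDerivWithinAt.mul h3).congr_deriv ?_
    ring
  obtain ⟨B, hB⟩ := (isCompact_Icc (a := (0 : ℝ)) (b := t)).exists_bound_of_continuousOn
    hδ.continuousOn
  obtain ⟨M, hM⟩ := (isCompact_Icc (a := (0 : ℝ)) (b := t)).exists_bound_of_continuousOn
    hphi.continuousOn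
  have hM0 : 0 ≤ M := (norm_nonneg _).trans (hM 0 ⟨le_rfl, ht⟩)
  have hmem : ∀ s ∈ uIoc 0 t, s ∈ Icc 0 t := fun s hs => by
    rw [uIoc_of_le ht] at hs
    exact ⟨hs.1.le, hs.2⟩
  set C := B + 2 * |lam| + ‖1 - 1 / z‖ * (|lam| + B)
  have hbound : ∀ n, ∀ s ∈ uIoc 0 t, ‖W n s‖ ≤
      M * (C * (consZero (fun k => q k s) n + q n s + q (n + 1) s)) := by
    intro n s hs
    have hs' := hmem s hs
    have h1 := hq.nonneg n s hs'.1
    have h2 := hq.nonneg (n + 1) s hs'.1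
    have h3 : 0 ≤ consZero (fun k => q k s) n := by
      cases n with
      | zero => exact le_rfl
      | succ n => exact hq.nonneg n s hs'.1
    have hδB : |δ s| ≤ B := hB s hs'
    have hzn : ‖z ^ n‖ ≤ 1 := by
      rw [norm_pow]
      exact pow_le_one₀ (norm_nonneg _) hz
    rw [norm_mul]
    refine mul_le_mul (hM s hs') ((norm_add_le _ _).trans ?_) (norm_nonneg _) hM0
    rw [add_mul]
    refine add_le_add ?_ ?_
    · rw [norm_mul, Complex.norm_real]
      refine (mul_le_of_le_one_right (norm_nonneg _) hzn).trans
        ((abs_kolmogorov_le hq n hs'.1).trans ?_)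
      gcongr
    · have hB0 : 0 ≤ B := (abs_nonneg _).trans hδB
      rw [norm_mul, norm_mul, norm_mul, Complex.norm_real]
      have h4 : ‖(lam : ℂ) - z * δ s‖ ≤ |lam| + B := by
        refine (norm_sub_le _ _).trans ?_
        rw [norm_mul, Complex.norm_real, Complex.norm_real]
        refine add_le_add le_rfl ?_
        exact (mul_le_of_le_one_left (norm_nonneg _) hz).trans hδB
      have h5 : ‖q n s‖ * ‖z ^ n‖ ≤ consZero (fun k => q k s) n + q n s + q (n + 1) s := by
        refine (mul_le_of_le_one_right (norm_nonneg _) hzn).trans ?_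
        rw [Real.norm_of_nonneg h1]
        linarith
      gcongr
  have hsum := intervalIntegral.hasSum_integral_of_dominated_convergence
    (μ := volume) (a := 0) (b := t) (F := W)
    (f := fun s => phi lam δ z s * ((1 - 1 / z) * (lam * q 0 s)))
    (fun n s => M * (C * (consZero (fun k => q k s) n + q n s + q (n + 1) s)))
    (fun n => (hW n).aestronglyMeasurable)
    (fun n => ae_of_all _ (hbound n))
    (ae_of_all _ fun s hs => (((hasSum_consZero_add hq (hmem s hs).1).mul_left C).mul_left M).summable)
    (by
      have h1 : Continuous fun s => M * (C * (3 - q 0 s)) := by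
        have := hqc 0
        fun_prop
      refine (h1.intervalIntegrable 0 t).congr fun s hs => ?_
      exact (((hasSum_consZero_add hq (hmem s hs).1).mul_left C).mul_left M).tsum_eq.symm)
    (ae_of_all _ fun s hs => by
      have hs' := hmem s hs
      have h1 := hasSum_kolmogorov_mul_pow hq hz hz0 hs'.1
      have h2 := hasSum_initialGen (fun k => hq.nonneg k s hs'.1) (hq.hasSum_one s hs'.1) hz
      exact hasSum_of_eq ((h1.add (h2.mul_left ((1 - 1 / z) * (lam - z * δ s)))).mul_left
        (phi lam δ z s)) (fun n => by simp only [W]) (by ring))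
  simp only [hint] at hsum
  have hp : HasSum (fun n => (p n : ℂ) * z ^ n) (initialGen p z) := by
    have := hasSum_initialGen (fun k => hq.nonneg k 0 le_rfl) (hq.hasSum_one 0 le_rfl) hz
    simpa only [hq.initial] using this
  have hG := (hasSum_initialGen (fun k => hq.nonneg k t ht) (hq.hasSum_one t ht) hz).mul_left
    (phi lam δ z t)
  rw [hsum.unique (hG.sub hp), add_sub_cancel]

/-- The probability of an empty queue solves the Volterra equation. -/
theorem volterra_of_isQueueLaw (hq : IsQueueLaw lam p δ q) (hδ : Continuous δ)
    (hqc : ∀ n, Continuous (q n)) {r : ℝ} (hr : 0 < r) (hr1 : r ≤ 1) {t : ℝ} (ht : 0 ≤ t) :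
    (q 0 t : ℂ) = psi lam p r δ t +
      (lam : ℂ) * ∫ s in (0 : ℝ)..t, kernelD lam r δ s t * (q 0 s : ℂ) := by
  have hp : ∀ k, 0 ≤ p k := fun k => hq.initial k ▸ hq.nonneg k 0 le_rfl
  have hp1 : HasSum p 1 := by simpa only [hq.initial] using hq.hasSum_one 0 le_rfl
  have hq0 := hqc 0
  have hsphere : Metric.sphere (0 : ℂ) r ⊆ Metric.closedBall 0 1 :=
    Metric.sphere_subset_closedBall.trans (Metric.closedBall_subset_closedBall hr1)
  have hne : ∀ z ∈ Metric.sphere (0 : ℂ) r, z ≠ 0 := fun z hz h0 => by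
    rw [mem_sphere_zero_iff_norm, h0, norm_zero] at hz
    exact hr.ne hz
  have hci1 : CircleIntegrable (fun z => initialGen (fun n => q n t) z / z) 0 r :=
    (((continuousOn_initialGen (fun k => hq.nonneg k t ht) (hq.hasSum_one t ht)).mono hsphere).div
      continuousOn_id hne).circleIntegrable hr.le
  have hphic : ContinuousOn (fun z => phi lam δ z t) (Metric.sphere (0 : ℂ) r) := by
    simp only [phi_eq_exp lam hδ, phiExponent]
    refine ContinuousOn.cexp (ContinuousOn.mul (continuousOn_const.sub
      (continuousOn_const.div continuousOn_id hne)) (by fun_prop))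
  have hci2 : CircleIntegrable (fun z => initialGen p z / (z * phi lam δ z t)) 0 r :=
    (((continuousOn_initialGen hp hp1).mono hsphere).div (continuousOn_id.mul hphic)
      fun z hz => mul_ne_zero (hne z hz) (phi_ne_zero _ _ _ _)).circleIntegrable hr.le
  -- This is `phi_mul_initialGen` divided by `z φ(z,t)` and integrated over the circle.
  have hdiff : (∮ z in C((0 : ℂ), r), initialGen (fun n => q n t) z / z) -
      (∮ z in C((0 : ℂ), r), initialGen p z / (z * phi lam δ z t)) =
      ∮ z in C((0 : ℂ), r), ∫ s in (0 : ℝ)..t,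
        phi lam δ z s / phi lam δ z t * ((1 - 1 / z) / z) * (lam * q 0 s) := by
    rw [← circleIntegral.integral_sub hci1 hci2]
    refine circleIntegral.integral_congr hr.le fun z hz => ?_
    have hz0 := hne z hz
    have hφ := phi_ne_zero lam δ z t
    have h := phi_mul_initialGen hq hδ hqc
      ((mem_closedBall_zero_iff.1 (hsphere hz))) hz0 ht
    have h1 : ∀ s : ℝ, phi lam δ z s / phi lam δ z t * ((1 - 1 / z) / z) * (lam * q 0 s) =
        (z * phi lam δ z t)⁻¹ * (phi lam δ z s * ((1 - 1 / z) * (lam * q 0 s))) := by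
      intro s
      field_simp
    simp only [h1]
    rw [intervalIntegral.integral_const_mul, ← sub_eq_iff_eq_add'.2 h]
    field_simp
  have hcont : Continuous fun x : ℝ × ℝ => phi lam δ (circleMap 0 r x.1) x.2 /
      phi lam δ (circleMap 0 r x.1) t *
        ((1 - 1 / circleMap 0 r x.1) / circleMap 0 r x.1) * (lam * q 0 x.2) :=
    (continuous_kernelD_integrand lam hδ hr t).mul (by fun_prop)
  rw [circleIntegral_intervalIntegral_swap (f := fun z s =>
    phi lam δ z s / phi lam δ z t * ((1 - 1 / z) / z) * (lam * q 0 s)) hcont] at hdiff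
  have hcauchy := circleIntegral_initialGen_div (fun k => hq.nonneg k t ht) (hq.hasSum_one t ht)
    hr hr1
  rw [← hcauchy, psi, sub_eq_iff_eq_add'.1 hdiff, mul_add, ← intervalIntegral.integral_const_mul,
    ← intervalIntegral.integral_const_mul]
  congr 1
  refine intervalIntegral.integral_congr fun s _ => ?_
  have h2 : (∮ z in C((0 : ℂ), r),
      phi lam δ z s / phi lam δ z t * ((1 - 1 / z) / z) * (lam * q 0 s)) =
      (∮ z in C((0 : ℂ), r), phi lam δ z s / phi lam δ z t * ((1 - 1 / z) / z)) *
        (lam * q 0 s) := by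
    simpa only [mul_comm _ ((lam : ℂ) * q 0 s)] using
      circleIntegral.integral_const_mul ((lam : ℂ) * q 0 s)
        (fun z => phi lam δ z s / phi lam δ z t * ((1 - 1 / z) / z)) 0 r
  simp only [h2, kernelD]
  ring

end

/-! ### Dependence of `ψ` and `D` on the rate, and uniqueness -/

theorem norm_exp_sub_exp_le {a b : ℂ} {M : ℝ} (ha : ‖a‖ ≤ M) (hb : ‖b‖ ≤ M) :
    ‖Complex.exp a - Complex.exp b‖ ≤ Real.exp M * ‖a - b‖ := by
  refine (convex_closedBall (0 : ℂ) M).norm_image_sub_le_of_norm_hasDerivWithin_le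
    (fun z _ => (Complex.hasDerivAt_exp z).hasDerivWithinAt) (fun z hz => ?_)
    (mem_closedBall_zero_iff.2 hb) (mem_closedBall_zero_iff.2 ha)
  rw [Complex.norm_exp, Real.exp_le_exp]
  exact (Complex.re_le_norm z).trans (mem_closedBall_zero_iff.1 hz)

section Estimates

variable {lam r T A : ℝ} {p : ℕ → ℝ} {δ δ' : ℝ → ℝ}

/-- A bound for the exponent of `φ` on the circle `|z| = r`. -/
noncomputable def exponentBound (lam r T A : ℝ) : ℝ := (1 + r⁻¹) * (lam * T + A)

theorem norm_one_sub_inv_le {z : ℂ} (hz : ‖z‖ = r) : ‖1 - 1 / z‖ ≤ 1 + r⁻¹ := by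
  refine (norm_sub_le _ _).trans_eq ?_
  rw [norm_one, norm_div, norm_one, hz, one_div]

theorem norm_phiExponent_le (hlam : 0 ≤ lam) (hr : 0 < r) (hr1 : r ≤ 1) {z : ℂ} (hz : ‖z‖ = r)
    {t : ℝ} (ht : 0 ≤ t) (htT : t ≤ T) (hA : |∫ s in (0 : ℝ)..t, δ s| ≤ A) :
    ‖phiExponent lam δ z t‖ ≤ exponentBound lam r T A := by
  rw [phiExponent, exponentBound, norm_mul]
  refine mul_le_mul (norm_one_sub_inv_le hz) ?_ (norm_nonneg _) (by positivity)
  refine (norm_sub_le _ _).trans (add_le_add ?_ ?_)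
  · rw [norm_mul, Complex.norm_real, Complex.norm_real, Real.norm_of_nonneg hlam,
      Real.norm_of_nonneg ht]
    exact mul_le_mul_of_nonneg_left htT hlam
  · rw [norm_mul, Complex.norm_real, hz]
    exact (mul_le_of_le_one_left (norm_nonneg _) hr1).trans hA

/-- The rate enters only through its primitive, with coefficient `-(1 - 1/z) z = 1 - z`: the pole
cancels, and the constant does not depend on `r`. -/
theorem norm_phiExponent_sub_le (hr : 0 < r) (hr1 : r ≤ 1) {z : ℂ} (hz : ‖z‖ = r) (t : ℝ) :
    ‖phiExponent lam δ z t - phiExponent lam δ' z t‖ ≤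
      2 * |(∫ s in (0 : ℝ)..t, δ s) - ∫ s in (0 : ℝ)..t, δ' s| := by
  have hz0 : z ≠ 0 := norm_ne_zero_iff.1 (hz ▸ hr.ne')
  have h : phiExponent lam δ z t - phiExponent lam δ' z t =
      (1 - z) * (((∫ s in (0 : ℝ)..t, δ s) - ∫ s in (0 : ℝ)..t, δ' s : ℝ) : ℂ) := by
    rw [phiExponent, phiExponent]
    push_cast
    field_simp
    ring
  rw [h, norm_mul, Complex.norm_real]
  refine mul_le_mul_of_nonneg_right ((norm_sub_le _ _).trans ?_) (norm_nonneg _)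
  rw [norm_one, hz]
  linarith

theorem continuousOn_phi_sphere (hδ : Continuous δ) (hr : 0 < r) (t : ℝ) :
    ContinuousOn (fun z => phi lam δ z t) (Metric.sphere (0 : ℂ) r) := by
  have hne : ∀ z ∈ Metric.sphere (0 : ℂ) r, z ≠ 0 := fun z hz => Metric.ne_of_mem_sphere hz hr.ne'
  simp only [phi_eq_exp lam hδ, phiExponent]
  exact ContinuousOn.cexp (ContinuousOn.mul (continuousOn_const.sub
    (continuousOn_const.div continuousOn_id hne)) (by fun_prop))

theorem circleIntegrable_psi (hp : ∀ k, 0 ≤ p k) (hp1 : HasSum p 1) (hδ : Continuous δ)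
    (hr : 0 < r) (hr1 : r ≤ 1) (t : ℝ) :
    CircleIntegrable (fun z => initialGen p z / (z * phi lam δ z t)) 0 r :=
  (((continuousOn_initialGen hp hp1).mono (Metric.sphere_subset_closedBall.trans
    (Metric.closedBall_subset_closedBall hr1))).div
    (continuousOn_id.mul (continuousOn_phi_sphere hδ hr t)) fun _ hz =>
      mul_ne_zero (Metric.ne_of_mem_sphere hz hr.ne') (phi_ne_zero _ _ _ _)).circleIntegrable hr.le

theorem circleIntegrable_kernelD (hδ : Continuous δ) (hr : 0 < r) (s t : ℝ) :
    CircleIntegrable (fun z => phi lam δ z s / phi lam δ z t * ((1 - 1 / z) / z)) 0 r := by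
  have hne : ∀ z ∈ Metric.sphere (0 : ℂ) r, z ≠ 0 := fun z hz => Metric.ne_of_mem_sphere hz hr.ne'
  exact (((continuousOn_phi_sphere hδ hr s).div (continuousOn_phi_sphere hδ hr t)
    fun _ _ => phi_ne_zero _ _ _ _).mul ((continuousOn_const.sub
    (continuousOn_const.div continuousOn_id hne)).div continuousOn_id hne)).circleIntegrable hr.le

theorem norm_psi_sub_le (hlam : 0 ≤ lam) (hp : ∀ k, 0 ≤ p k) (hp1 : HasSum p 1)
    (hδ : Continuous δ) (hδ' : Continuous δ') (hr : 0 < r) (hr1 : r ≤ 1)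
    {t : ℝ} (ht : 0 ≤ t) (htT : t ≤ T) (hA : |∫ s in (0 : ℝ)..t, δ s| ≤ A)
    (hA' : |∫ s in (0 : ℝ)..t, δ' s| ≤ A) :
    ‖psi lam p r δ t - psi lam p r δ' t‖ ≤ Real.exp (exponentBound lam r T A) *
      (2 * |(∫ s in (0 : ℝ)..t, δ s) - ∫ s in (0 : ℝ)..t, δ' s|) := by
  rw [psi, psi, ← mul_sub, ← circleIntegral.integral_sub (circleIntegrable_psi hp hp1 hδ hr hr1 t)
    (circleIntegrable_psi hp hp1 hδ' hr hr1 t), ← smul_eq_mul]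
  set X := Real.exp (exponentBound lam r T A) *
      (2 * |(∫ s in (0 : ℝ)..t, δ s) - ∫ s in (0 : ℝ)..t, δ' s|) with hX
  refine (circleIntegral.norm_two_pi_i_inv_smul_integral_le_of_norm_le_const hr.le
    (C := r⁻¹ * X) fun z hz => ?_).trans_eq (mul_inv_cancel_left₀ hr.ne' X)
  have hzr : ‖z‖ = r := mem_sphere_zero_iff_norm.1 hz
  have h1 : initialGen p z / (z * phi lam δ z t) - initialGen p z / (z * phi lam δ' z t) =
      initialGen p z * (z⁻¹ * (Complex.exp (-phiExponent lam δ z t) -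
        Complex.exp (-phiExponent lam δ' z t))) := by
    rw [phi_eq_exp lam hδ, phi_eq_exp lam hδ', Complex.exp_neg, Complex.exp_neg, div_eq_mul_inv,
      div_eq_mul_inv, mul_inv, mul_inv]
    ring
  rw [h1, norm_mul, norm_mul, norm_inv, hzr]
  refine (mul_le_of_le_one_left (by positivity)
    (norm_initialGen_le hp hp1 (hzr.trans_le hr1))).trans ?_
  refine mul_le_mul_of_nonneg_left ((norm_exp_sub_exp_le
    ((norm_neg _).trans_le (norm_phiExponent_le hlam hr hr1 hzr ht htT hA))
    ((norm_neg _).trans_le (norm_phiExponent_le hlam hr hr1 hzr ht htT hA'))).trans ?_)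
    (inv_nonneg.2 hr.le)
  rw [neg_sub_neg, norm_sub_rev]
  exact mul_le_mul_of_nonneg_left (norm_phiExponent_sub_le hr hr1 hzr t) (Real.exp_pos _).le

theorem norm_kernelD_le (hlam : 0 ≤ lam) (hδ : Continuous δ) (hr : 0 < r) (hr1 : r ≤ 1)
    {s t : ℝ} (hs : 0 ≤ s) (hsT : s ≤ T) (ht : 0 ≤ t) (htT : t ≤ T)
    (hAs : |∫ u in (0 : ℝ)..s, δ u| ≤ A) (hAt : |∫ u in (0 : ℝ)..t, δ u| ≤ A) :
    ‖kernelD lam r δ s t‖ ≤ Real.exp (2 * exponentBound lam r T A) * (1 + r⁻¹) := by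
  rw [kernelD, ← smul_eq_mul]
  refine (circleIntegral.norm_two_pi_i_inv_smul_integral_le_of_norm_le_const hr.le
    (C := r⁻¹ * (Real.exp (2 * exponentBound lam r T A) * (1 + r⁻¹))) fun z hz => ?_).trans_eq
      (mul_inv_cancel_left₀ hr.ne' _)
  have hzr : ‖z‖ = r := mem_sphere_zero_iff_norm.1 hz
  rw [phi_eq_exp lam hδ, phi_eq_exp lam hδ, ← Complex.exp_sub, norm_mul, norm_div, hzr,
    Complex.norm_exp, div_eq_mul_inv, mul_comm r⁻¹, mul_assoc _ (1 + r⁻¹)]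
  refine mul_le_mul (Real.exp_le_exp.2 ?_) (mul_le_mul_of_nonneg_right
    (norm_one_sub_inv_le hzr) (inv_nonneg.2 hr.le)) (by positivity) (Real.exp_pos _).le
  refine (Complex.re_le_norm _).trans ((norm_sub_le _ _).trans ?_)
  linarith [norm_phiExponent_le hlam hr hr1 hzr hs hsT hAs,
    norm_phiExponent_le hlam hr hr1 hzr ht htT hAt]

theorem norm_kernelD_sub_le (hlam : 0 ≤ lam) (hδ : Continuous δ) (hδ' : Continuous δ')
    (hr : 0 < r) (hr1 : r ≤ 1) {s t d : ℝ} (hs : 0 ≤ s) (hsT : s ≤ T) (ht : 0 ≤ t) (htT : t ≤ T)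
    (hAs : |∫ u in (0 : ℝ)..s, δ u| ≤ A) (hAt : |∫ u in (0 : ℝ)..t, δ u| ≤ A)
    (hAs' : |∫ u in (0 : ℝ)..s, δ' u| ≤ A) (hAt' : |∫ u in (0 : ℝ)..t, δ' u| ≤ A)
    (hds : |(∫ u in (0 : ℝ)..s, δ u) - ∫ u in (0 : ℝ)..s, δ' u| ≤ d)
    (hdt : |(∫ u in (0 : ℝ)..t, δ u) - ∫ u in (0 : ℝ)..t, δ' u| ≤ d) :
    ‖kernelD lam r δ s t - kernelD lam r δ' s t‖ ≤
      Real.exp (2 * exponentBound lam r T A) * (1 + r⁻¹) * (4 * d) := by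
  rw [kernelD, kernelD, ← mul_sub, ← circleIntegral.integral_sub
    (circleIntegrable_kernelD hδ hr s t) (circleIntegrable_kernelD hδ' hr s t), ← smul_eq_mul]
  refine (circleIntegral.norm_two_pi_i_inv_smul_integral_le_of_norm_le_const hr.le
    (C := r⁻¹ * (Real.exp (2 * exponentBound lam r T A) * (1 + r⁻¹) * (4 * d)))
    fun z hz => ?_).trans_eq (mul_inv_cancel_left₀ hr.ne' _)
  have hzr : ‖z‖ = r := mem_sphere_zero_iff_norm.1 hz
  have b1 := norm_phiExponent_le hlam hr hr1 hzr hs hsT hAs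
  have b2 := norm_phiExponent_le hlam hr hr1 hzr ht htT hAt
  have b3 := norm_phiExponent_le hlam hr hr1 hzr hs hsT hAs'
  have b4 := norm_phiExponent_le hlam hr hr1 hzr ht htT hAt'
  have d1 := norm_phiExponent_sub_le (lam := lam) (δ := δ) (δ' := δ') hr hr1 hzr s
  have d2 := norm_phiExponent_sub_le (lam := lam) (δ := δ) (δ' := δ') hr hr1 hzr t
  rw [phi_eq_exp lam hδ, phi_eq_exp lam hδ, phi_eq_exp lam hδ', phi_eq_exp lam hδ',
    ← Complex.exp_sub, ← Complex.exp_sub, ← sub_mul, norm_mul, norm_div, hzr]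
  have e1 : ‖Complex.exp (phiExponent lam δ z s - phiExponent lam δ z t) -
      Complex.exp (phiExponent lam δ' z s - phiExponent lam δ' z t)‖ ≤
      Real.exp (2 * exponentBound lam r T A) * (4 * d) := by
    refine (norm_exp_sub_exp_le (M := 2 * exponentBound lam r T A)
      ((norm_sub_le _ _).trans (by linarith))
      ((norm_sub_le _ _).trans (by linarith))).trans ?_
    refine mul_le_mul_of_nonneg_left ?_ (Real.exp_pos _).le
    rw [sub_sub_sub_comm]
    refine (norm_sub_le _ _).trans ?_
    linarith
  have e2 : ‖1 - 1 / z‖ / r ≤ (1 + r⁻¹) * r⁻¹ :=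
    mul_le_mul_of_nonneg_right (norm_one_sub_inv_le hzr) (inv_nonneg.2 hr.le)
  refine (mul_le_mul e1 e2 (by positivity) ((norm_nonneg _).trans e1)).trans_eq ?_
  ring

end Estimates

theorem abs_integral_sub_le {f g : ℝ → ℝ} (hf : Continuous f) (hg : Continuous g) {s t : ℝ}
    (hs : 0 ≤ s) (hst : s ≤ t) :
    |(∫ u in (0 : ℝ)..s, f u) - ∫ u in (0 : ℝ)..s, g u| ≤ ∫ u in (0 : ℝ)..t, |f u - g u| := by
  rw [← intervalIntegral.integral_sub (hf.intervalIntegrable _ _) (hg.intervalIntegrable _ _)]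
  have hc : Continuous fun u => |f u - g u| := by fun_prop
  refine (intervalIntegral.abs_integral_le_integral_abs hs).trans ?_
  exact intervalIntegral.integral_mono_interval le_rfl hs hst
    (ae_of_all _ fun u => abs_nonneg _) (hc.intervalIntegrable _ _)

/-- Stability of the Volterra equation with respect to the arrival rate. -/
theorem exists_abs_sub_le_of_volterra {lam r T : ℝ} {p : ℕ → ℝ} {δ δ' H H' : ℝ → ℝ}
    (hlam : 0 ≤ lam) (hp : ∀ k, 0 ≤ p k) (hp1 : HasSum p 1) (hr : 0 < r) (hr1 : r ≤ 1)
    (hδ : Continuous δ) (hδ' : Continuous δ') (hH : Continuous H) (hH' : Continuous H')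
    (hV : ∀ t, 0 ≤ t → (H t : ℂ) = psi lam p r δ t +
      (lam : ℂ) * ∫ s in (0 : ℝ)..t, kernelD lam r δ s t * (H s : ℂ))
    (hV' : ∀ t, 0 ≤ t → (H' t : ℂ) = psi lam p r δ' t +
      (lam : ℂ) * ∫ s in (0 : ℝ)..t, kernelD lam r δ' s t * (H' s : ℂ)) :
    ∃ C, 0 ≤ C ∧ ∀ t ∈ Icc 0 T, |H t - H' t| ≤
      C * ∫ s in (0 : ℝ)..t, (|δ s - δ' s| + |H s - H' s|) := by
  have hJ : ∀ {f : ℝ → ℝ}, Continuous f → Continuous fun t => ∫ s in (0 : ℝ)..t, f s := fun hf =>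
    intervalIntegral.continuous_primitive (fun _ _ => hf.intervalIntegrable _ _) 0
  obtain ⟨A₁, hA₁⟩ := (isCompact_Icc (a := (0 : ℝ)) (b := T)).exists_bound_of_continuousOn
    (hJ hδ).continuousOn
  obtain ⟨A₂, hA₂⟩ := (isCompact_Icc (a := (0 : ℝ)) (b := T)).exists_bound_of_continuousOn
    (hJ hδ').continuousOn
  obtain ⟨B, hB⟩ := (isCompact_Icc (a := (0 : ℝ)) (b := T)).exists_bound_of_continuousOn
    hH'.continuousOn
  set A := max A₁ A₂
  have hA : ∀ t ∈ Icc 0 T, |∫ s in (0 : ℝ)..t, δ s| ≤ A := fun t ht =>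
    (hA₁ t ht).trans (le_max_left _ _)
  have hA' : ∀ t ∈ Icc 0 T, |∫ s in (0 : ℝ)..t, δ' s| ≤ A := fun t ht =>
    (hA₂ t ht).trans (le_max_right _ _)
  set E := Real.exp (exponentBound lam r T A)
  set K := Real.exp (2 * exponentBound lam r T A) * (1 + r⁻¹)
  have hE : 0 ≤ E := (Real.exp_pos _).le
  have hK : 0 ≤ K := by positivity
  have hcδ : Continuous fun s => |δ s - δ' s| := by fun_prop
  have hcH : Continuous fun s => |H s - H' s| := by fun_prop
  -- `2 * E` comes from `ψ`, `lam * K` from the difference of `H` and `H'` under the kernel, and `K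
  -- * 4 * |B| * |T|` from the difference of the kernels against `H'`, bounded by `B` on `[0, T]`.
  refine ⟨2 * E + lam * (K + K * 4 * |B| * |T|), by positivity, fun t ht => ?_⟩
  have hT : 0 ≤ T := ht.1.trans ht.2
  set Δ := ∫ s in (0 : ℝ)..t, |δ s - δ' s| with hΔ
  set Y := ∫ s in (0 : ℝ)..t, |H s - H' s| with hY
  have hΔ0 : 0 ≤ Δ := intervalIntegral.integral_nonneg ht.1 fun _ _ => abs_nonneg _
  have hY0 : 0 ≤ Y := intervalIntegral.integral_nonneg ht.1 fun _ _ => abs_nonneg _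
  have hd : ∀ s ∈ Icc 0 t, |(∫ u in (0 : ℝ)..s, δ u) - ∫ u in (0 : ℝ)..s, δ' u| ≤ Δ := fun s hs =>
    abs_integral_sub_le hδ hδ' hs.1 hs.2
  have hdt := hd t ⟨ht.1, le_rfl⟩
  have hsT : ∀ s ∈ Icc 0 t, s ∈ Icc 0 T := fun s hs => ⟨hs.1, hs.2.trans ht.2⟩
  have hDc := continuous_kernelD lam hδ hr t
  have hDc' := continuous_kernelD lam hδ' hr t
  have hi1 : IntervalIntegrable (fun s => kernelD lam r δ s t * (H s : ℂ)) volume 0 t :=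
    (hDc.mul (by fun_prop)).intervalIntegrable _ _
  have hi2 : IntervalIntegrable (fun s => kernelD lam r δ' s t * (H' s : ℂ)) volume 0 t :=
    (hDc'.mul (by fun_prop)).intervalIntegrable _ _
  have hintegrand : ∀ s ∈ Icc 0 t, ‖kernelD lam r δ s t * (H s : ℂ) -
      kernelD lam r δ' s t * (H' s : ℂ)‖ ≤ K * |H s - H' s| + K * (4 * Δ) * |B| := by
    intro s hs
    have hs' := hsT s hs
    have heq : kernelD lam r δ s t * (H s : ℂ) - kernelD lam r δ' s t * (H' s : ℂ) =
        kernelD lam r δ s t * ((H s - H' s : ℝ) : ℂ) +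
          (kernelD lam r δ s t - kernelD lam r δ' s t) * (H' s : ℂ) := by
      push_cast
      ring
    rw [heq]
    refine (norm_add_le _ _).trans (add_le_add ?_ ?_)
    · rw [norm_mul, Complex.norm_real]
      exact mul_le_mul_of_nonneg_right (norm_kernelD_le hlam hδ hr hr1 hs'.1 hs'.2 ht.1 ht.2
        (hA s hs') (hA t ht)) (norm_nonneg _)
    · rw [norm_mul, Complex.norm_real]
      exact mul_le_mul (norm_kernelD_sub_le hlam hδ hδ' hr hr1 hs'.1 hs'.2 ht.1 ht.2 (hA s hs')
        (hA t ht) (hA' s hs') (hA' t ht) (hd s hs) hdt) ((hB s hs').trans (le_abs_self B))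
        (norm_nonneg _) (by positivity)
  have hcb : Continuous fun s => K * |H s - H' s| + K * (4 * Δ) * |B| := by fun_prop
  have hint : ‖(∫ s in (0 : ℝ)..t, kernelD lam r δ s t * (H s : ℂ)) -
      ∫ s in (0 : ℝ)..t, kernelD lam r δ' s t * (H' s : ℂ)‖ ≤
      K * Y + K * 4 * |B| * |T| * Δ := by
    rw [← intervalIntegral.integral_sub hi1 hi2]
    refine (intervalIntegral.norm_integral_le_of_norm_le ht.1
      (ae_of_all _ fun s hs => hintegrand s ⟨hs.1.le, hs.2⟩) (hcb.intervalIntegrable _ _)).trans ?_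
    rw [intervalIntegral.integral_add ((hcH.const_mul K).intervalIntegrable _ _)
      (continuous_const.intervalIntegrable _ _), intervalIntegral.integral_const_mul,
      intervalIntegral.integral_const, smul_eq_mul, sub_zero]
    have : t * (K * (4 * Δ) * |B|) ≤ |T| * (K * (4 * Δ) * |B|) :=
      mul_le_mul_of_nonneg_right (ht.2.trans (le_abs_self T)) (by positivity)
    linarith
  have hpsi := norm_psi_sub_le hlam hp hp1 hδ hδ' hr hr1 ht.1 ht.2 (hA t ht) (hA' t ht)
  have hmain : |H t - H' t| ≤ 2 * E * Δ + lam * (K * Y + K * 4 * |B| * |T| * Δ) := by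
    have heq : ((H t - H' t : ℝ) : ℂ) = (psi lam p r δ t - psi lam p r δ' t) +
        (lam : ℂ) * ((∫ s in (0 : ℝ)..t, kernelD lam r δ s t * (H s : ℂ)) -
          ∫ s in (0 : ℝ)..t, kernelD lam r δ' s t * (H' s : ℂ)) := by
      rw [Complex.ofReal_sub, hV t ht.1, hV' t ht.1]
      ring
    rw [← Real.norm_eq_abs, ← Complex.norm_real, heq]
    refine (norm_add_le _ _).trans (add_le_add (hpsi.trans ?_) ?_)
    · have := mul_le_mul_of_nonneg_left hdt hE
      linarith
    · rw [norm_mul, Complex.norm_real, Real.norm_of_nonneg hlam]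
      exact mul_le_mul_of_nonneg_left hint hlam
  rw [intervalIntegral.integral_add (hcδ.intervalIntegrable _ _) (hcH.intervalIntegrable _ _)]
  refine hmain.trans ?_
  have h1 : 0 ≤ 2 * E * Y := by positivity
  have h2 : 0 ≤ lam * (K * Δ) := by positivity
  have h3 : 0 ≤ lam * (K * 4 * |B| * |T| * Y) := by positivity
  linarith

theorem eq_zero_of_le_mul_integral {f : ℝ → ℝ} (hf : Continuous f) (hf0 : ∀ t, 0 ≤ f t) {C T : ℝ}
    (h : ∀ t ∈ Icc 0 T, f t ≤ C * ∫ s in (0 : ℝ)..t, f s) : ∀ t ∈ Icc 0 T, f t = 0 := by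
  intro t ht
  have hder : ∀ s, HasDerivAt (fun t => ∫ s in (0 : ℝ)..t, f s) (f s) s := fun s =>
    (hf.integral_hasStrictDerivAt 0 s).hasDerivAt
  have hnn : ∀ s, 0 ≤ s → 0 ≤ ∫ u in (0 : ℝ)..s, f u := fun s hs =>
    intervalIntegral.integral_nonneg hs fun u _ => hf0 u
  have hg := norm_le_gronwallBound_of_norm_deriv_right_le
    (f := fun t => ∫ s in (0 : ℝ)..t, f s) (f' := f) (δ := 0) (K := C) (ε := 0) (a := 0) (b := T)
    (fun s _ => (hder s).continuousAt.continuousWithinAt)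
    (fun s _ => (hder s).hasDerivWithinAt) (by simp)
    (fun s hs => by
      rw [Real.norm_of_nonneg (hf0 s), Real.norm_of_nonneg (hnn s hs.1), add_zero]
      exact h s ⟨hs.1, hs.2.le⟩) t ht
  rw [gronwallBound_ε0_δ0, Real.norm_of_nonneg (hnn t ht.1)] at hg
  have h0 := h t ht
  rw [le_antisymm hg (hnn t ht.1), mul_zero] at h0
  exact le_antisymm h0 (hf0 t)

/-- Grönwall for the sum of both differences. Leaving `hC` as a hypothesis serves two uses: the
differential equation supplies it for uniqueness of the pair, and `C = 0` works when the two rates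
coincide. -/
theorem eq_of_volterra {lam r : ℝ} {p : ℕ → ℝ} {δ δ' H H' : ℝ → ℝ}
    (hlam : 0 ≤ lam) (hp : ∀ k, 0 ≤ p k) (hp1 : HasSum p 1) (hr : 0 < r) (hr1 : r ≤ 1)
    (hδ : Continuous δ) (hδ' : Continuous δ') (hH : Continuous H) (hH' : Continuous H')
    (hV : ∀ t, 0 ≤ t → (H t : ℂ) = psi lam p r δ t +
      (lam : ℂ) * ∫ s in (0 : ℝ)..t, kernelD lam r δ s t * (H s : ℂ))
    (hV' : ∀ t, 0 ≤ t → (H' t : ℂ) = psi lam p r δ' t +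
      (lam : ℂ) * ∫ s in (0 : ℝ)..t, kernelD lam r δ' s t * (H' s : ℂ)) {C : ℝ}
    (hC : ∀ t, 0 ≤ t → |δ t - δ' t| ≤
      C * ∫ s in (0 : ℝ)..t, (|δ s - δ' s| + |H s - H' s|)) {t : ℝ} (ht : 0 ≤ t) :
    δ t = δ' t ∧ H t = H' t := by
  obtain ⟨C', -, hC'⟩ := exists_abs_sub_le_of_volterra (T := t) hlam hp hp1 hr hr1 hδ hδ' hH hH'
    hV hV'
  have h := eq_zero_of_le_mul_integral (f := fun s => |δ s - δ' s| + |H s - H' s|) (by fun_prop)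
    (fun s => by positivity) (C := C + C') (T := t) (fun s hs => by
      rw [add_mul]
      exact add_le_add (hC s hs.1) (hC' s hs)) t ⟨ht, le_rfl⟩
  have h1 := abs_nonneg (δ t - δ' t)
  have h2 := abs_nonneg (H t - H' t)
  exact ⟨sub_eq_zero.1 (abs_eq_zero.1 (by linarith)), sub_eq_zero.1 (abs_eq_zero.1 (by linarith))⟩

section Solutions

variable {lam mu r : ℝ} {p : ℕ → ℝ} {δ δ' H H' : ℝ → ℝ}

theorem volterra_congr {f g F G : ℝ → ℝ} (hfg : ∀ t, 0 ≤ t → f t = g t)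
    (hFG : ∀ t, 0 ≤ t → F t = G t)
    (hV : ∀ t, 0 ≤ t → (F t : ℂ) = psi lam p r f t +
      (lam : ℂ) * ∫ s in (0 : ℝ)..t, kernelD lam r f s t * (F s : ℂ)) {t : ℝ} (ht : 0 ≤ t) :
    (G t : ℂ) = psi lam p r g t +
      (lam : ℂ) * ∫ s in (0 : ℝ)..t, kernelD lam r g s t * (G s : ℂ) := by
  rw [← hFG t ht, hV t ht, psi_congr lam p r ht hfg]
  congr 2
  refine intervalIntegral.integral_congr fun s hs => ?_
  rw [uIcc_of_le ht] at hs
  simp only [kernelD_congr lam r hs.1 ht hfg, hFG s hs.1]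

theorem IsSolution.continuousOn_rate (h : IsSolution lam mu p r δ H) :
    ContinuousOn δ (Ici 0) := fun t ht => (h.deriv t ht).continuousWithinAt

theorem IsSolution.extend (h : IsSolution lam mu p r δ H) :
    IsSolution lam mu p r (fun t => δ (max t 0)) fun t => H (max t 0) where
  continuousOn := (continuous_comp_max_zero h.continuousOn).continuousOn
  initial := by simpa using h.initial
  deriv t ht := by
    simp only [max_eq_left ht]
    exact (h.deriv t ht).congr (fun s hs => by simp [max_eq_left (show 0 ≤ s from hs)])
      (by simp [max_eq_left ht])
  volterra t ht := volterra_congr (f := δ) (F := H) (g := fun t => δ (max t 0))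
    (G := fun t => H (max t 0)) (fun t ht => by simp [max_eq_left ht])
    (fun t ht => by simp [max_eq_left ht]) h.volterra ht

theorem IsSolution.abs_rate_sub_le (hlam : 0 ≤ lam) (hmu : 0 ≤ mu)
    (h : IsSolution lam mu p r δ H) (h' : IsSolution lam mu p r δ' H') (hδ : Continuous δ)
    (hδ' : Continuous δ') (hH : Continuous H) (hH' : Continuous H') {t : ℝ} (ht : 0 ≤ t) :
    |δ t - δ' t| ≤ (lam * mu + mu) * ∫ s in (0 : ℝ)..t, (|δ s - δ' s| + |H s - H' s|) := by
  have hftc := intervalIntegral.integral_eq_sub_of_hasDeriv_right_of_le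
    (f := fun t => δ t - δ' t)
    (f' := fun t => lam * mu * (1 - H t) - mu * δ t - (lam * mu * (1 - H' t) - mu * δ' t)) ht
    (by fun_prop)
    (fun s hs => ((h.deriv s hs.1.le).sub (h'.deriv s hs.1.le)).mono (Ioi_subset_Ici hs.1.le))
    (Continuous.intervalIntegrable (by fun_prop) _ _)
  simp only [h.initial, h'.initial, sub_zero] at hftc
  rw [← hftc, ← intervalIntegral.integral_const_mul, ← Real.norm_eq_abs]
  refine intervalIntegral.norm_integral_le_of_norm_le ht (ae_of_all _ fun s _ => ?_)
    (Continuous.intervalIntegrable (by fun_prop) _ _)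
  have heq : lam * mu * (1 - H s) - mu * δ s - (lam * mu * (1 - H' s) - mu * δ' s) =
      -(lam * mu * (H s - H' s)) - mu * (δ s - δ' s) := by ring
  rw [heq]
  refine (norm_sub_le _ _).trans ?_
  rw [norm_neg, norm_mul, norm_mul mu, Real.norm_of_nonneg hmu, Real.norm_of_nonneg
    (mul_nonneg hlam hmu), Real.norm_eq_abs, Real.norm_eq_abs]
  have h1 : 0 ≤ lam * mu * |δ s - δ' s| := by positivity
  have h2 : 0 ≤ mu * |H s - H' s| := by positivity
  linarith

theorem IsSolution.unique (hlam : 0 ≤ lam) (hmu : 0 ≤ mu) (hp : ∀ k, 0 ≤ p k) (hp1 : HasSum p 1)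
    (hr : 0 < r) (hr1 : r ≤ 1) (h : IsSolution lam mu p r δ H)
    (h' : IsSolution lam mu p r δ' H') {t : ℝ} (ht : 0 ≤ t) : δ t = δ' t ∧ H t = H' t := by
  have c1 := continuous_comp_max_zero h.continuousOn_rate
  have c2 := continuous_comp_max_zero h'.continuousOn_rate
  have c3 := continuous_comp_max_zero h.continuousOn
  have c4 := continuous_comp_max_zero h'.continuousOn
  simpa [max_eq_left ht] using eq_of_volterra hlam hp hp1 hr hr1 c1 c2 c3 c4 h.extend.volterra
    h'.extend.volterra
    (fun s hs => h.extend.abs_rate_sub_le hlam hmu h'.extend c1 c2 c3 c4 hs) ht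

theorem IsQueueLaw.volterra {q : ℕ → ℝ → ℝ} (hq : IsQueueLaw lam p δ q)
    (hδ : ContinuousOn δ (Ici 0)) (hr : 0 < r) (hr1 : r ≤ 1) {t : ℝ} (ht : 0 ≤ t) :
    (q 0 t : ℂ) = psi lam p r δ t +
      (lam : ℂ) * ∫ s in (0 : ℝ)..t, kernelD lam r δ s t * (q 0 s : ℂ) :=
  volterra_congr (f := fun t => δ (max t 0)) (F := fun t => q 0 (max t 0))
    (fun t ht => by simp [max_eq_left ht]) (fun t ht => by simp [max_eq_left ht])
    (fun _ ht => volterra_of_isQueueLaw hq.extend (continuous_comp_max_zero hδ)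
      (fun n => continuous_comp_max_zero (hq.continuousOn n)) hr hr1 ht) ht

theorem IsSolution.eq_empty_probability (hlam : 0 ≤ lam) (hp : ∀ k, 0 ≤ p k) (hp1 : HasSum p 1)
    (hr : 0 < r) (hr1 : r ≤ 1) (h : IsSolution lam mu p r δ H) {q : ℕ → ℝ → ℝ}
    (hq : IsQueueLaw lam p δ q) {t : ℝ} (ht : 0 ≤ t) : H t = q 0 t := by
  have c1 := continuous_comp_max_zero h.continuousOn_rate
  have c2 := continuous_comp_max_zero h.continuousOn
  have c3 := continuous_comp_max_zero (hq.continuousOn 0)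
  have := (eq_of_volterra (C := 0) hlam hp hp1 hr hr1 c1 c1 c2 c3 h.extend.volterra
    (fun s hs => hq.extend.volterra c1.continuousOn hr hr1 hs)
    (fun s hs => by simp) ht).2
  simpa [max_eq_left ht] using this

end Solutions

/-! ### The equilibrium of mass `U`, and the theorem -/

/-- The parameter of the geometric equilibrium law. -/
theorem exists_equilibrium {lam mu U : ℝ} (hlam : 0 < lam) (hmu : 0 < mu)
    (hU : 0 < U) : ∃ x : ℝ, 0 < x ∧ x < 1 ∧ lam / mu * x + x / (1 - x) = U ∧
      lam * x = mu * (U + lam / mu + 1 -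
          Real.sqrt ((U + lam / mu + 1) ^ 2 - 4 * (lam / mu) * U)) / 2 := by
  have hrho : 0 < lam / mu := div_pos hlam hmu
  have hlamrho : lam = mu * (lam / mu) := by field_simp
  set ρ := lam / mu
  set S := Real.sqrt ((U + ρ + 1) ^ 2 - 4 * ρ * U) with hS
  have hS2 : S ^ 2 = (U + ρ + 1) ^ 2 - 4 * ρ * U :=
    Real.sq_sqrt (by nlinarith [sq_nonneg (U - ρ)])
  have hS0 : 0 ≤ S := Real.sqrt_nonneg _
  have hSlt : S < U + ρ + 1 := by
    refine lt_of_pow_lt_pow_left₀ 2 (by positivity) ?_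
    rw [hS2]
    nlinarith [mul_pos hrho hU]
  -- The squares differ by `4 * ρ`; this gives `x < 1`.
  have hSgt : U + 1 - ρ < S := by
    refine lt_of_pow_lt_pow_left₀ 2 hS0 ?_
    rw [hS2]
    nlinarith
  -- The smaller root of `ρ x² - (U + ρ + 1) x + U = 0`, which is the mass equation cleared of its
  -- denominator.
  set x := (U + ρ + 1 - S) / (2 * ρ) with hx
  have hxS : 2 * ρ * x = U + ρ + 1 - S := by
    rw [hx]
    field_simp
  have hx0 : 0 < x := div_pos (by linarith) (by positivity)
  have hx1 : x < 1 := by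
    rw [hx, div_lt_one (by positivity)]
    linarith
  refine ⟨x, hx0, hx1, ?_, ?_⟩
  · have h1 : 1 - x ≠ 0 := (sub_pos.2 hx1).ne'
    have hquad : ρ * x ^ 2 - (U + ρ + 1) * x + U = 0 := by
      have h2 : S = U + ρ + 1 - 2 * ρ * x := by linarith
      rw [h2] at hS2
      have h3 : 4 * ρ * (ρ * x ^ 2 - (U + ρ + 1) * x + U) = 0 := by linarith
      exact (mul_eq_zero.1 h3).resolve_left (by positivity)
    field_simp
    linarith
  · rw [hlamrho]
    linear_combination mu / 2 * hxS

end TandemQueue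

theorem mainTheorem2 (lam mu U : ℝ) (hlam : 0 < lam) (hmu : 0 < mu) (hU : 0 < U)
    (p : ℕ → ℝ) (hp : ∀ k, 0 ≤ p k) (hp1 : HasSum p 1)
    (hpU : HasSum (fun k : ℕ => (k : ℝ) * p k) U)
    (r : ℝ) (hr : 0 < r) (hr1 : r ≤ 1) :
    ∃ δ H : ℝ → ℝ,
      TandemQueue.IsSolution lam mu p r δ H ∧
      (∀ δ' H' : ℝ → ℝ, TandemQueue.IsSolution lam mu p r δ' H' →
        ∀ t : ℝ, 0 ≤ t → δ' t = δ t ∧ H' t = H t) ∧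
      (∀ t : ℝ, 0 ≤ t → 0 ≤ δ t) ∧
      (∃ q : ℕ → ℝ → ℝ, TandemQueue.IsQueueLaw lam p δ q) ∧
      (∀ q : ℕ → ℝ → ℝ, TandemQueue.IsQueueLaw lam p δ q → ∀ t : ℝ, 0 ≤ t → H t = q 0 t) ∧
      ∃ d : ℝ, Filter.Tendsto δ Filter.atTop (nhds d) ∧ 0 < d ∧
        d = mu * (U + lam / mu + 1 -
          Real.sqrt ((U + lam / mu + 1) ^ 2 - 4 * (lam / mu) * U)) / 2 := by
  -- The pair is built as `(δ, q 0)` from the Kolmogorov system with feedback, so `δ ≥ 0` and the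
  -- existence of a law come with it.
  obtain ⟨δ, q, hq, hδ0, hδ, hδ'⟩ := TandemQueue.exists_isQueueLaw_of_feedback hlam hmu hp hp1
  have hsol : TandemQueue.IsSolution lam mu p r δ (q 0) :=
    { continuousOn := hq.continuousOn 0
      initial := hδ0
      deriv := hδ'
      volterra := fun t ht =>
        hq.volterra (fun t ht => (hδ' t ht).continuousWithinAt) hr hr1 ht }
  obtain ⟨x, hx0, hx1, hxU, hxd⟩ := TandemQueue.exists_equilibrium hlam hmu hU
  exact ⟨δ, q 0, hsol, fun δ' H' h' t ht => h'.unique hlam.le hmu.le hp hp1 hr hr1 hsol ht, hδ,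
    ⟨q, hq⟩, fun q' hq' t ht => hsol.eq_empty_probability hlam.le hp hp1 hr hr1 hq' ht,
    lam * x, (hq.isTailFlow hp hp1 hpU hδ0 hδ hδ').tendsto_rate hlam.le hmu hx0 hx1 hxU,
    mul_pos hlam hx0, hxd⟩
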